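/- On $L^2(\mathbb R)$ let $Df(x)=\sqrt2 f(2x)$, $T_\alpha f(x)=f(x-\alpha)$, $T=T_1$, and $\hat f(\xi)=\frac1{\sqrt{2\pi}}\int f(x)e^{-ix\xi}\,dx$ (extended unitarily). A wavelet is a $\psi\in L^2(\mathbb R)$ such that $\{D^nT^l\psi:n,l\in\mathbb Z\}$ is an orthonormal basis of $L^2(\mathbb R)$; its core space is $V_0=\overline{\mathrm{span}}\{D^nT^l\psi:n<0,\ l\in\mathbb Z\}$. It is an MRA wavelet if $V_0$ has an orthonormal basis of the form $\{T^l\varphi:l\in\mathbb Z\}$. Let $\mathcal L_n$ be the set of wavelets whose core space is invariant under all $T_{m/2^n}$, $m\in\mathbb Z$, and $\mathcal M_n=\mathcal L_n\setminus\mathcal L_{n+1}$. A wavelet set is a measurable $W\subset\mathbb R$ such that $\hat\psi_W=\frac1{\sqrt{2\pi}}\chi_W$ defines a wavelet $\psi_W$ (an MSF wavelet). In each of the four cases below, $W_1$ and $W_2$ are wavelet sets; there is a measurable bijection $\sigma:\mathbb R\to\mathbb R$ with measurable inverse and $\sigma(2\xi)=2\sigma(\xi)$, mapping $W_1$ bijectively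 onto $W_2$, with $\sigma(\xi)-\xi\in2\pi\mathbb Z$ for $\xi\in W_1$, and given on $W_1$ by $\sigma(\xi)=\xi$ on $W_1\cap W_2$ and the displayed formulas; $\sigma$ is involutive ($\sigma^2=\mathrm{id}$); and there are measurable, essentially bounded functions $h_1,h_2$ with $h_i(2\xi)=h_i(\xi)$, given by $$h_1=\chi_{W_1\cap W_2}+\tfrac1{\sqrt2}\chi_{A}\ \text{ on }W_1,\qquad h_2=\tfrac1{\sqrt2}(\chi_B-\chi_C)\ \text{ on }W_2,$$ for which the matrix $\begin{pmatrix}h_1&h_2\\ h_2\circ\sigma^{-1}&h_1\circ\sigma^{-1}\end{pmatrix}$ is unitary almost everywhere. The function $\psi$ with $\hat\psi=h_1\hat\psi_{W_1}+h_2\hat\psi_{W_2}$ is a wavelet, and: 1. $\psi\in\mathcal M_1$ for $W_1=[-\frac{8\pi}7,-\frac{4\pi}7)\cup[\frac{4\pi}7,\frac{6\pi}7)\cup[\frac{24\pi}7,\frac{32\pi}7)$, $W_2=[-\frac{8\pi}7,-\frac{4\pi}7)\cup[\frac{2\pi}7,\frac{3\pi}7)\cup[\frac{24\pi}7,\frac{30\pi}7)\cup[\frac{31\pi}7,\frac{32\pi}7)\cup[\frac{60\pi}7,\frac{62\pi}7)$;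 $\sigma(\xi)=\xi-4\pi$ on $[\frac{30\pi}7,\frac{31\pi}7)$, $\sigma(\xi)=\xi+8\pi$ on $[\frac{4\pi}7,\frac{6\pi}7)$; $A=[\frac{4\pi}7,\frac{6\pi}7)\cup[\frac{30\pi}7,\frac{31\pi}7)$, $B=[\frac{2\pi}7,\frac{3\pi}7)$, $C=[\frac{60\pi}7,\frac{62\pi}7)$. 2. $\psi\in\mathcal M_2$ for $W_1=[-8\pi,-\frac{112\pi}{15})\cup[-\frac{16\pi}{15},-\pi)\cup[-\frac{14\pi}{15},-\frac{8\pi}{15})\cup[\frac{8\pi}{15},\frac{14\pi}{15})\cup[\pi,\frac{16\pi}{15})\cup[\frac{112\pi}{15},8\pi)$, $W_2=[-8\pi,-\frac{112\pi}{15})\cup[-\frac{14\pi}{15},-\frac\pi2)\cup[\frac{8\pi}{15},\frac{14\pi}{15})\cup[\pi,\frac{16\pi}{15})\cup[\frac{225\pi}{30},8\pi)\cup[\frac{224\pi}{15},15\pi)$; $\sigma(\xi)=\xi-8\pi$ on $[\frac{112\pi}{15},\frac{225\pi}{30})$, $\sigma(\xi)=\xi+16\pi$ on $[-\frac{16\pi}{15},-\pi)$;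 $A=[-\frac{16\pi}{15},-\pi)\cup[\frac{112\pi}{15},\frac{225\pi}{30})$, $B=[-\frac{8\pi}{15},-\frac\pi2)$, $C=[\frac{224\pi}{15},15\pi)$. 3. $\psi\in\mathcal M_3$ for $W_1=[-16\pi,-\frac{480\pi}{31})\cup[-\frac{32\pi}{31},-\pi)\cup[-\frac{30\pi}{31},-\frac{16\pi}{31})\cup[\frac{16\pi}{31},\frac{30\pi}{31})\cup[\pi,\frac{32\pi}{31})\cup[\frac{480\pi}{31},16\pi)$, $W_2=[-16\pi,-\frac{480\pi}{31})\cup[-\frac{30\pi}{31},-\frac\pi2)\cup[\frac{16\pi}{31},\frac{30\pi}{31})\cup[\pi,\frac{32\pi}{31})\cup[\frac{31\pi}2,16\pi)\cup[\frac{960\pi}{31},31\pi)$; $\sigma(\xi)=\xi-16\pi$ on $[\frac{480\pi}{31},\frac{31\pi}2)$, $\sigma(\xi)=\xi+32\pi$ on $[-\frac{32\pi}{31},-\pi)$; $A=[-\frac{32\pi}{31},-\pi)\cup[\frac{480\pi}{31},\frac{31\pi}2)$, $B=[-\frac{16\pi}{31},-\frac\pi2)$, $C=[\frac{960\pi}{31},31\pi)$.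 4. $\psi\in\mathcal M_0$, and none of $\psi$, $\psi_{W_1}$, $\psi_{W_2}$ is an MRA wavelet, for $W_1=[-\frac{32\pi}7,-4\pi)\cup[-\pi,-\frac{4\pi}7)\cup[\frac{4\pi}7,\pi)\cup[4\pi,\frac{32\pi}7)$, $W_2=[-\frac{8\pi}7,-\frac{4\pi}7)\cup[\frac{4\pi}7,\frac{6\pi}7)\cup[\frac{24\pi}7,\frac{32\pi}7)$; $\sigma(\xi)=\xi-2\pi$ on $[\frac{6\pi}7,\pi)$, $\sigma(\xi)=\xi+8\pi$ on $[-\frac{32\pi}7,-4\pi)$; $A=[-\frac{32\pi}7,-4\pi)\cup[\frac{6\pi}7,\pi)$, $B=[-\frac{8\pi}7,-\pi)$, $C=[\frac{24\pi}7,4\pi)$. Consequently $\mathcal M_0,\mathcal M_1,\mathcal M_2,\mathcal M_3$ are non-empty. -/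

import Mathlib

open MeasureTheory FourierTransform

noncomputable section

namespace WaveletInvariance

/-- The Hilbert space `L²(ℝ)` of complex-valued functions. -/
abbrev L2R : Type := Lp ℂ 2 (volume : Measure ℝ)

/-! ### Translation and dilation operators, Fourier transform -/

/-- The translation operator `T_α f(x) = f(x - α)`. -/
def translation (α : ℝ) : L2R →ₗᵢ[ℂ] L2R :=
  Lp.compMeasurePreservingₗᵢ ℂ (fun x : ℝ => x - α) (measurePreserving_sub_right volume α)

theorem translation_coeFn (α : ℝ) (f : L2R) :
    translation α f =ᵐ[volume] fun x => f (x - α) :=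
  Lp.coeFn_compMeasurePreserving f (measurePreserving_sub_right volume α)

theorem memLp_scale {a : ℝ} (ha : 0 < a) {f : ℝ → ℂ} (hf : MemLp f 2 volume) :
    MemLp (fun x => (Real.sqrt a : ℂ) * f (a * x)) 2 volume := by
  refine MemLp.const_mul (f := fun x => f (a * x)) ?_ _
  refine MemLp.comp_of_map (f := fun x : ℝ => a * x) (g := f) ?_ (by fun_prop)
  rw [Real.map_volume_mul_left ha.ne']
  exact hf.smul_measure ENNReal.ofReal_ne_top

theorem eLpNorm_scale {a : ℝ} (ha : 0 < a) {f : ℝ → ℂ} (hf : AEStronglyMeasurable f volume) :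
    eLpNorm (fun x => (Real.sqrt a : ℂ) * f (a * x)) 2 volume = eLpNorm f 2 volume := by
  have h1 : eLpNorm (fun x => (Real.sqrt a : ℂ) * f (a * x)) 2 volume
      = ‖(Real.sqrt a : ℂ)‖ₑ * eLpNorm (f ∘ fun x => a * x) 2 volume :=
    eLpNorm_const_smul (Real.sqrt a : ℂ) (f ∘ fun x => a * x) 2 volume
  have hm : AEStronglyMeasurable f (Measure.map (fun x : ℝ => a * x) volume) := by
    rw [Real.map_volume_mul_left ha.ne']
    exact hf.smul_measure _
  rw [h1, ← eLpNorm_map_measure hm (by fun_prop), Real.map_volume_mul_left ha.ne',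
    eLpNorm_smul_measure_of_ne_top (by norm_num), smul_eq_mul, ← mul_assoc]
  have h2 : ‖(Real.sqrt a : ℂ)‖ₑ = ENNReal.ofReal (Real.sqrt a) := by
    rw [← ofReal_norm, Complex.norm_real, Real.norm_of_nonneg (Real.sqrt_nonneg a)]
  have h3 : (ENNReal.ofReal |a⁻¹|) ^ (1 / (2 : ENNReal)).toReal
      = ENNReal.ofReal ((Real.sqrt a)⁻¹) := by
    rw [abs_of_pos (inv_pos.2 ha), ENNReal.ofReal_rpow_of_pos (inv_pos.2 ha)]
    congr 1
    rw [Real.sqrt_eq_rpow, Real.inv_rpow ha.le]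
    norm_num
  rw [h2, h3, ← ENNReal.ofReal_mul (Real.sqrt_nonneg a),
    mul_inv_cancel₀ (Real.sqrt_pos.2 ha).ne', ENNReal.ofReal_one, one_mul]

theorem ae_comp_scale {a : ℝ} (ha : 0 < a) {p : ℝ → Prop} (h : ∀ᵐ x, p x) :
    ∀ᵐ x : ℝ, p (a * x) := by
  have : Measure.QuasiMeasurePreserving (fun x : ℝ => a * x) volume volume := by
    refine ⟨by fun_prop, ?_⟩
    rw [Real.map_volume_mul_left ha.ne']
    exact Measure.smul_absolutelyContinuous
  exact this.ae h

/-- The underlying function of the scaling operator. -/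
def scaleFun (a : ℝ) (ha : 0 < a) (f : L2R) : L2R := (memLp_scale ha (Lp.memLp f)).toLp _

theorem scaleFun_coeFn (a : ℝ) (ha : 0 < a) (f : L2R) :
    scaleFun a ha f =ᵐ[volume] fun x => (Real.sqrt a : ℂ) * f (a * x) :=
  MemLp.coeFn_toLp _

theorem scaleFun_scaleFun (a b : ℝ) (ha : 0 < a) (hb : 0 < b) (hab : a * b = 1) (f : L2R) :
    scaleFun a ha (scaleFun b hb f) = f := by
  apply Lp.ext
  filter_upwards [scaleFun_coeFn a ha (scaleFun b hb f),
    ae_comp_scale ha (scaleFun_coeFn b hb f)] with x h1 h2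
  rw [h1, h2, ← mul_assoc, ← Complex.ofReal_mul, ← Real.sqrt_mul ha.le, hab, ← mul_assoc,
    mul_comm b a, hab]
  simp

/-- The unitary scaling operator `f ↦ √a · f(a ·)` on `L²(ℝ)`, for `a > 0`. -/
def scale (a : ℝ) (ha : 0 < a) : L2R ≃ₗᵢ[ℂ] L2R where
  toFun := scaleFun a ha
  invFun := scaleFun a⁻¹ (inv_pos.2 ha)
  left_inv f := scaleFun_scaleFun _ _ _ _ (inv_mul_cancel₀ ha.ne') f
  right_inv f := scaleFun_scaleFun _ _ _ _ (mul_inv_cancel₀ ha.ne') f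
  map_add' f g := by
    apply Lp.ext
    filter_upwards [scaleFun_coeFn a ha (f + g), scaleFun_coeFn a ha f, scaleFun_coeFn a ha g,
      Lp.coeFn_add (scaleFun a ha f) (scaleFun a ha g),
      ae_comp_scale ha (Lp.coeFn_add f g)] with x h1 h2 h3 h4 h5
    rw [h1, h4, Pi.add_apply, h2, h3, h5, Pi.add_apply, mul_add]
  map_smul' c f := by
    apply Lp.ext
    filter_upwards [scaleFun_coeFn a ha (c • f), scaleFun_coeFn a ha f,
      Lp.coeFn_smul c (scaleFun a ha f),
      ae_comp_scale ha (Lp.coeFn_smul c f)] with x h1 h2 h4 h5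
    rw [h1, RingHom.id_apply, h4, Pi.smul_apply, h2, h5, Pi.smul_apply, smul_eq_mul, smul_eq_mul,
      mul_left_comm]
  norm_map' f := by
    change ‖scaleFun a ha f‖ = ‖f‖
    rw [scaleFun, Lp.norm_toLp, eLpNorm_scale ha (Lp.aestronglyMeasurable f), Lp.norm_def]

theorem scale_coeFn (a : ℝ) (ha : 0 < a) (f : L2R) :
    scale a ha f =ᵐ[volume] fun x => (Real.sqrt a : ℂ) * f (a * x) :=
  scaleFun_coeFn a ha f

/-- The dyadic dilation operator `D f(x) = √2 f(2x)`. -/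
def dilation : L2R ≃ₗᵢ[ℂ] L2R := scale 2 two_pos

/-- The unitary Fourier transform `f̂(ξ) = (2π)^(-1/2) ∫ f(x) e^(-i x ξ) dx` on `L²(ℝ)`.
Mathlib's `𝓕 f(ξ) = ∫ f(x) e^(-2 π i x ξ) dx` is rescaled by `1 / (2π)`. -/
def fourierHat (f : L2R) : L2R :=
  scale (1 / (2 * Real.pi)) (one_div_pos.2 Real.two_pi_pos) (𝓕 f)

/-! ### Wavelets and the translation invariance of their core spaces -/

/-- The element `D^n T^l ψ` of the affine system of `ψ`. -/
def affine (ψ : L2R) (n l : ℤ) : L2R := (dilation ^ n) (translation (l : ℝ) ψ)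

/-- `ψ` is a wavelet: `{D^n T^l ψ : n, l ∈ ℤ}` is an orthonormal basis of `L²(ℝ)`. -/
def IsWavelet (ψ : L2R) : Prop :=
  Orthonormal ℂ (fun p : ℤ × ℤ => affine ψ p.1 p.2) ∧
    (Submodule.span ℂ (Set.range fun p : ℤ × ℤ => affine ψ p.1 p.2)).topologicalClosure = ⊤

/-- The core space `V₀`: the closed span of `{D^n T^l ψ : n < 0, l ∈ ℤ}`. -/
def coreSpace (ψ : L2R) : Submodule ℂ L2R :=
  (Submodule.span ℂ {f | ∃ n l : ℤ, n < 0 ∧ f = affine ψ n l}).topologicalClosure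

/-- Invariance of a subspace under the group `𝒢ₙ` of translations by `m / 2ⁿ`, `m ∈ ℤ`. -/
def InvariantUnder (V : Submodule ℂ L2R) (n : ℕ) : Prop :=
  ∀ m : ℤ, ∀ f ∈ V, translation ((m : ℝ) / 2 ^ n) f ∈ V

/-- `ℒₙ`: the wavelets whose core space is invariant under `𝒢ₙ`. -/
def classL (n : ℕ) : Set L2R := {ψ | IsWavelet ψ ∧ InvariantUnder (coreSpace ψ) n}

/-- `ℳₙ = ℒₙ ∖ ℒₙ₊₁`. -/
def classM (n : ℕ) : Set L2R := classL n \ classL (n + 1)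

/-- `ψ` is an MRA wavelet: it is a wavelet and its core space has a scaling function, i.e. a
function `φ` whose integer translates form an orthonormal basis of `V₀`. -/
def IsMRAWavelet (ψ : L2R) : Prop :=
  IsWavelet ψ ∧ ∃ φ : L2R, Orthonormal ℂ (fun l : ℤ => translation (l : ℝ) φ) ∧
    (Submodule.span ℂ (Set.range fun l : ℤ => translation (l : ℝ) φ)).topologicalClosure =
      coreSpace ψ

/-! ### MSF wavelets and operator interpolation -/

/-- `ψ` is the MSF wavelet with wavelet set `W`: `ψ` is a wavelet and
`ψ̂ = (2π)^(-1/2) χ_W` almost everywhere. -/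
structure IsMSFWavelet (W : Set ℝ) (ψ : L2R) : Prop where
  measurableSet : MeasurableSet W
  fourier_eq : fourierHat ψ =ᵐ[volume]
    W.indicator fun _ => (((Real.sqrt (2 * Real.pi))⁻¹ : ℝ) : ℂ)
  isWavelet : IsWavelet ψ

/-- `σ` is the measurable bijection of `ℝ` that on `W₁` is effected by the `2π` translation
congruence of `W₁` and `W₂`, extended to `ℝ` by 2-homogeneity. -/
structure IsInterpolationMap (W₁ W₂ : Set ℝ) (σ : ℝ ≃ᵐ ℝ) : Prop where
  bijOn : Set.BijOn σ W₁ W₂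
  congruence : ∀ x ∈ W₁, ∃ k : ℤ, σ x = x + 2 * k * Real.pi
  homogeneous : ∀ x, σ (2 * x) = 2 * σ x

/-- `h` is measurable, essentially bounded and 2-dilation periodic. -/
structure IsInterpolationCoeff (h : ℝ → ℂ) : Prop where
  measurable : Measurable h
  essBounded : ∃ C : ℝ, ∀ᵐ x : ℝ, ‖h x‖ ≤ C
  periodic : ∀ x, h (2 * x) = h x

/-- `ψ` is the wavelet obtained by operator interpolation between the MSF wavelets `ψ₁`, `ψ₂` of
`W₁`, `W₂`, with involutive interpolation map `σ` and coefficients `h₁`, `h₂`. -/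
structure IsInterpolatedWavelet (W₁ W₂ : Set ℝ) (σ : ℝ ≃ᵐ ℝ) (h₁ h₂ : ℝ → ℂ)
    (ψ₁ ψ₂ ψ : L2R) : Prop where
  msf₁ : IsMSFWavelet W₁ ψ₁
  msf₂ : IsMSFWavelet W₂ ψ₂
  interpolationMap : IsInterpolationMap W₁ W₂ σ
  involutive : Function.Involutive σ
  coeff₁ : IsInterpolationCoeff h₁
  coeff₂ : IsInterpolationCoeff h₂
  unitary : ∀ᵐ ξ : ℝ, !![h₁ ξ, h₂ ξ; h₂ (σ.symm ξ), h₁ (σ.symm ξ)] ∈ Matrix.unitaryGroup (Fin 2) ℂ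
  fourier_eq : fourierHat ψ =ᵐ[volume]
    fun ξ => h₁ ξ * fourierHat ψ₁ ξ + h₂ ξ * fourierHat ψ₂ ξ
  isWavelet : IsWavelet ψ

/-- The half-open interval `[aπ, bπ)`. -/
def piIco (a b : ℝ) : Set ℝ := Set.Ico (a * Real.pi) (b * Real.pi)

/-- The characteristic function `χ_S`. -/
def chi (S : Set ℝ) : ℝ → ℂ := S.indicator 1

/-- The number `1/√2`. -/
def invSqrtTwo : ℂ := ((1 / Real.sqrt 2 : ℝ) : ℂ)

/-! ### The four pairs of wavelet sets -/

/-- First set for `ℳ₁`. -/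
def set₁M₁ : Set ℝ := piIco (-8 / 7) (-4 / 7) ∪ piIco (4 / 7) (6 / 7) ∪ piIco (24 / 7) (32 / 7)

/-- Second set for `ℳ₁`. -/
def set₂M₁ : Set ℝ := piIco (-8 / 7) (-4 / 7) ∪ piIco (2 / 7) (3 / 7) ∪ piIco (24 / 7) (30 / 7) ∪
  piIco (31 / 7) (32 / 7) ∪ piIco (60 / 7) (62 / 7)

/-- First set for `ℳ₂`. -/
def set₁M₂ : Set ℝ := piIco (-8) (-112 / 15) ∪ piIco (-16 / 15) (-1) ∪
  piIco (-14 / 15) (-8 / 15) ∪ piIco (8 / 15) (14 / 15) ∪ piIco 1 (16 / 15) ∪ piIco (112 / 15) 8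

/-- Second set for `ℳ₂`. -/
def set₂M₂ : Set ℝ := piIco (-8) (-112 / 15) ∪ piIco (-14 / 15) (-1 / 2) ∪
  piIco (8 / 15) (14 / 15) ∪ piIco 1 (16 / 15) ∪ piIco (225 / 30) 8 ∪ piIco (224 / 15) 15

/-- First set for `ℳ₃`. -/
def set₁M₃ : Set ℝ := piIco (-16) (-480 / 31) ∪ piIco (-32 / 31) (-1) ∪
  piIco (-30 / 31) (-16 / 31) ∪ piIco (16 / 31) (30 / 31) ∪ piIco 1 (32 / 31) ∪
  piIco (480 / 31) 16

/-- Second set for `ℳ₃`. -/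
def set₂M₃ : Set ℝ := piIco (-16) (-480 / 31) ∪ piIco (-30 / 31) (-1 / 2) ∪
  piIco (16 / 31) (30 / 31) ∪ piIco 1 (32 / 31) ∪ piIco (31 / 2) 16 ∪ piIco (960 / 31) 31

/-- First set for `ℳ₀`. -/
def set₁M₀ : Set ℝ := piIco (-32 / 7) (-4) ∪ piIco (-1) (-4 / 7) ∪ piIco (4 / 7) 1 ∪
  piIco 4 (32 / 7)

/-- Second set for `ℳ₀`. -/
def set₂M₀ : Set ℝ := piIco (-8 / 7) (-4 / 7) ∪ piIco (4 / 7) (6 / 7) ∪ piIco (24 / 7) (32 / 7)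

end WaveletInvariance

end

open WaveletInvariance

/-! On the Fourier side $D^nT^l\psi$ becomes the $2^n$-dilate of $e^{-il\xi}\hat\psi$. If $W$ tiles
the line both under dyadic dilations and under $2\pi$-translations, the exponentials form an
orthogonal basis of $L^2(W)$ and the dilates of $W$ fill the line, so $\psi_W$ is a wavelet
(`isWavelet_msf`).

All four pairs have one shape (`SwapData`): $W_1=P\cup I\cup 2^j(I-c)$, $W_2=P\cup(I-c)\cup 2^jI$
with $c=2^N\cdot2\pi$ and $j>0$. The map $\sigma$ exchanges $2^nx$ with $2^n(x-c)$ for $x\in I$ and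
fixes the orbits of $P$; the coefficients form a rotation by $45^\circ$ on the exchanged orbits.
Hence $Uf=h_1f+h_2\,(f\circ\sigma)$ is unitary, and homogeneity together with $2\pi$-congruence
makes $U$ carry the affine system of $\psi_{W_1}$ to that of $\psi$ (`fourierHat_affine_eq`). So
$\psi$ is a wavelet, and $f\in V_0$ exactly when $U^*\hat f=0$ on $E=\bigcup_{n\ge0}2^nW_1$
(`mem_coreSpace_iff`).

Translation by $\alpha$ is multiplication by $e^{-i\alpha\xi}$. On $E$ the displacement of $\sigma$
is an integer multiple of $c$, so the character with $\alpha=m/2^N$ is $\sigma$-invariant there and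
$V_0$ is invariant. For $\alpha=1/2^{N+1}$ the character changes sign between $I\subset E$ and
$I-c$, which misses $E$; since $h_1h_2\ne0$ on $I$, invariance fails (`mem_classM`).

A scaling function would make the vectors $(\hat f(\xi),\hat f(\xi+2\pi))$, $f\in V_0$, proportional
to a single vector. In the last case the part $P$ common to both wavelet sets places the indicators
of some $S$ and of $S+2\pi$ in all three core spaces, which excludes this
(`not_isMRAWavelet_of_indicator_mem`). -/

noncomputable section

namespace WaveletInvariance

open scoped ComplexConjugate

/-! ### Multiplication operators -/

/-- A measurable function bounded by `1`. -/
structure UnitBounded (u : ℝ → ℂ) : Prop where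
  measurable : Measurable u
  norm_le : ∀ x, ‖u x‖ ≤ 1

theorem UnitBounded.conj {u : ℝ → ℂ} (hu : UnitBounded u) : UnitBounded fun x => conj (u x) :=
  ⟨Complex.continuous_conj.measurable.comp hu.measurable, fun x => by
    simpa using hu.norm_le x⟩

theorem UnitBounded.comp {u : ℝ → ℂ} (hu : UnitBounded u) {τ : ℝ → ℝ} (hτ : Measurable τ) :
    UnitBounded fun x => u (τ x) :=
  ⟨hu.measurable.comp hτ, fun x => hu.norm_le (τ x)⟩

theorem unitBounded_indicator {S : Set ℝ} (hS : MeasurableSet S) :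
    UnitBounded (S.indicator fun _ => 1) :=
  ⟨measurable_const.indicator hS, fun x => by
    by_cases h : x ∈ S <;> simp [h]⟩

theorem UnitBounded.memLp_mul {u : ℝ → ℂ} (hu : UnitBounded u) (f : L2R) :
    MemLp (fun x => u x * f x) 2 volume :=
  (Lp.memLp f).of_le (hu.measurable.aestronglyMeasurable.mul (Lp.aestronglyMeasurable f))
    (Filter.Eventually.of_forall fun x => by
      rw [norm_mul]
      exact mul_le_of_le_one_left (norm_nonneg _) (hu.norm_le x))

/-- Multiplication by a measurable function bounded by `1`, as an operator on `L²(ℝ)`. -/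
def mulOp (u : ℝ → ℂ) (hu : UnitBounded u) : L2R →L[ℂ] L2R :=
  LinearMap.mkContinuous
    { toFun := fun f => (hu.memLp_mul f).toLp _
      map_add' := fun f g => by
        apply Lp.ext
        filter_upwards [(hu.memLp_mul (f + g)).coeFn_toLp, (hu.memLp_mul f).coeFn_toLp,
          (hu.memLp_mul g).coeFn_toLp, Lp.coeFn_add f g,
          Lp.coeFn_add ((hu.memLp_mul f).toLp _) ((hu.memLp_mul g).toLp _)] with x h1 h2 h3 h4 h5
        rw [h1, h5, Pi.add_apply, h2, h3, h4, Pi.add_apply, mul_add]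
      map_smul' := fun c f => by
        apply Lp.ext
        filter_upwards [(hu.memLp_mul (c • f)).coeFn_toLp, (hu.memLp_mul f).coeFn_toLp,
          Lp.coeFn_smul c f, Lp.coeFn_smul c ((hu.memLp_mul f).toLp _)] with x h1 h2 h3 h4
        rw [h1, RingHom.id_apply, h4, Pi.smul_apply, h2, h3, Pi.smul_apply, smul_eq_mul,
          smul_eq_mul, mul_left_comm] }
    1 fun f => by
      rw [one_mul]
      apply Lp.norm_le_norm_of_ae_le
      filter_upwards [(hu.memLp_mul f).coeFn_toLp] with x h
      change ‖((hu.memLp_mul f).toLp _ : L2R) x‖ ≤ _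
      rw [h, norm_mul]
      exact mul_le_of_le_one_left (norm_nonneg _) (hu.norm_le x)

theorem mulOp_coeFn (u : ℝ → ℂ) (hu : UnitBounded u) (f : L2R) :
    mulOp u hu f =ᵐ[volume] fun x => u x * f x :=
  (hu.memLp_mul f).coeFn_toLp

theorem schwartz_ae_toLp_eq (s : SchwartzMap ℝ ℂ) :
    ∀ᵐ x : ℝ, (s.toLp 2 : L2R) x = s x :=
  s.coeFn_toLp 2 volume

/-- The character `ξ ↦ e^(-i α ξ)`. -/
def expo (α x : ℝ) : ℂ := Complex.exp (-(Complex.I * α * x))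

theorem norm_expo (α x : ℝ) : ‖expo α x‖ = 1 := by
  rw [expo, show -(Complex.I * α * x) = ((-(α * x) : ℝ) : ℂ) * Complex.I by push_cast; ring]
  exact Complex.norm_exp_ofReal_mul_I _

theorem unitBounded_expo (α : ℝ) : UnitBounded (expo α) :=
  ⟨by unfold expo; fun_prop, fun x => (norm_expo α x).le⟩

theorem expo_add_right (α x y : ℝ) : expo α (x + y) = expo α x * expo α y := by
  rw [expo, expo, expo, ← Complex.exp_add]; push_cast; ring_nf

theorem expo_mul_left (α β x : ℝ) : expo (α * β) x = expo α (β * x) := by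
  rw [expo, expo]; push_cast; ring_nf

theorem expo_two_pi (α : ℝ) (m : ℤ) (h : α = m) (k : ℤ) : expo α (2 * k * Real.pi) = 1 := by
  rw [expo, Complex.exp_eq_one_iff]
  exact ⟨-(m * k), by rw [h]; push_cast; ring⟩

/-! ### The Fourier transform, translations and dilations -/

theorem scale_scale (a b : ℝ) (ha : 0 < a) (hb : 0 < b) (f : L2R) :
    scale a ha (scale b hb f) = scale (a * b) (mul_pos ha hb) f := by
  apply Lp.ext
  filter_upwards [scale_coeFn a ha (scale b hb f), ae_comp_scale ha (scale_coeFn b hb f),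
    scale_coeFn _ (mul_pos ha hb) f] with x h1 h2 h3
  rw [h1, h2, h3, ← mul_assoc, ← Complex.ofReal_mul, ← Real.sqrt_mul ha.le, ← mul_assoc,
    mul_comm b a]

theorem scale_congr {a b : ℝ} (ha : 0 < a) (hb : 0 < b) (h : a = b) (f : L2R) :
    scale a ha f = scale b hb f := by subst h; rfl

theorem scale_one (f : L2R) : scale 1 one_pos f = f := by
  apply Lp.ext
  filter_upwards [scale_coeFn 1 one_pos f] with x h
  rw [h]; simp

/-- The unitary Fourier transform as a linear isometric equivalence. -/
def fourierEquivL2 : L2R ≃ₗᵢ[ℂ] L2R :=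
  (Lp.fourierTransformₗᵢ ℝ ℂ).trans (scale (1 / (2 * Real.pi)) (one_div_pos.2 Real.two_pi_pos))

theorem fourierEquivL2_apply (f : L2R) : fourierEquivL2 f = fourierHat f := rfl

/-- Both sides are continuous in `f`, so Schwartz functions suffice; there it is the substitution
$y\mapsto y+\alpha$ in the Fourier integral. The factor $2\pi$ comes from the normalisation of `𝓕`.
-/
theorem fourier_translation (α : ℝ) (f : L2R) :
    𝓕 (translation α f) = mulOp (expo (α * (2 * Real.pi))) (unitBounded_expo _) (𝓕 f) := by
  refine DenseRange.induction_on (p := fun f : L2R => 𝓕 (translation α f) =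
    mulOp (expo (α * (2 * Real.pi))) (unitBounded_expo _) (𝓕 f))
    (SchwartzMap.denseRange_toLpCLM (F := ℂ) (p := 2) ENNReal.ofNat_ne_top) f ?_ ?_
  · apply isClosed_eq
    · exact (Lp.fourierTransformₗᵢ ℝ ℂ).continuous.comp (translation α).continuous
    · exact (ContinuousLinearMap.continuous _).comp (Lp.fourierTransformₗᵢ ℝ ℂ).continuous
  intro s
  rw [SchwartzMap.toLpCLM_apply]
  have h1 : translation α (s.toLp 2) = (s.compSubConstCLM ℂ α).toLp 2 := by
    apply Lp.ext
    filter_upwards [translation_coeFn α (s.toLp 2), (s.compSubConstCLM ℂ α).coeFn_toLp 2,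
      (measurePreserving_sub_right volume α).quasiMeasurePreserving.ae (schwartz_ae_toLp_eq s)]
      with x h1 h2 h3
    rw [h1, h2, h3]; rfl
  rw [h1, SchwartzMap.toLp_fourier_eq, SchwartzMap.toLp_fourier_eq]
  apply Lp.ext
  filter_upwards [(𝓕 (s.compSubConstCLM ℂ α)).coeFn_toLp 2, (𝓕 s).coeFn_toLp 2,
    mulOp_coeFn _ (unitBounded_expo (α * (2 * Real.pi))) ((𝓕 s).toLp 2)] with x h1 h2 h3
  rw [h1, h3, h2, SchwartzMap.fourier_coe, SchwartzMap.fourier_coe, Real.fourier_eq',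
    Real.fourier_eq', ← integral_const_mul,
    ← integral_add_right_eq_self _ α]
  refine integral_congr_ae (Filter.Eventually.of_forall fun y => ?_)
  simp only [SchwartzMap.compSubConstCLM_apply, smul_eq_mul, expo, ← mul_assoc, ← Complex.exp_add]
  rw [add_sub_cancel_right]
  congr 2
  simp
  ring

/-- The same density argument; the change of variables contributes the Jacobian $a^{-1}$, and $\sqrt
a\,a^{-1}=\sqrt{a^{-1}}$. -/
theorem fourier_scale (a : ℝ) (ha : 0 < a) (f : L2R) :
    𝓕 (scale a ha f) = scale a⁻¹ (inv_pos.2 ha) (𝓕 f) := by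
  refine DenseRange.induction_on (p := fun f : L2R => 𝓕 (scale a ha f) =
    scale a⁻¹ (inv_pos.2 ha) (𝓕 f))
    (SchwartzMap.denseRange_toLpCLM (F := ℂ) (p := 2) ENNReal.ofNat_ne_top) f ?_ ?_
  · apply isClosed_eq
    · exact (Lp.fourierTransformₗᵢ ℝ ℂ).continuous.comp (scale a ha).continuous
    · exact (scale a⁻¹ (inv_pos.2 ha)).continuous.comp (Lp.fourierTransformₗᵢ ℝ ℂ).continuous
  intro s
  rw [SchwartzMap.toLpCLM_apply]
  set t : SchwartzMap ℝ ℂ := (Real.sqrt a : ℂ) • SchwartzMap.compCLMOfContinuousLinearEquiv ℂ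
    (ContinuousLinearEquiv.unitsEquivAut ℝ (Units.mk0 a ha.ne')) s with ht
  have ht' : ∀ x, t x = Real.sqrt a * s (a * x) := fun x => by
    simp [ht, mul_comm]
  have h1 : scale a ha (s.toLp 2) = t.toLp 2 := by
    apply Lp.ext
    filter_upwards [scale_coeFn a ha (s.toLp 2), t.coeFn_toLp 2,
      ae_comp_scale ha (schwartz_ae_toLp_eq s)]
      with x h1 h2 h3
    rw [h1, h2, h3, ht']
  rw [h1, SchwartzMap.toLp_fourier_eq, SchwartzMap.toLp_fourier_eq]
  apply Lp.ext
  filter_upwards [(𝓕 t).coeFn_toLp 2, ae_comp_scale (inv_pos.2 ha) (schwartz_ae_toLp_eq (𝓕 s)),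
    scale_coeFn a⁻¹ (inv_pos.2 ha) ((𝓕 s).toLp 2)] with x h1 h2 h3
  rw [h1, h3, h2, SchwartzMap.fourier_coe, SchwartzMap.fourier_coe, Real.fourier_eq',
    Real.fourier_eq']
  have h4 := Measure.integral_comp_mul_left (fun y : ℝ => Complex.exp
    (((-2 * Real.pi * inner ℝ y (a⁻¹ * x) : ℝ) : ℂ) * Complex.I) • s y) a
  have h5 : ∀ v : ℝ, Complex.exp (((-2 * Real.pi * inner ℝ v x : ℝ) : ℂ) * Complex.I) • t v =
      (Real.sqrt a : ℂ) * (Complex.exp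
    (((-2 * Real.pi * inner ℝ (a * v) (a⁻¹ * x) : ℝ) : ℂ) * Complex.I) • s (a * v)) := fun v => by
    rw [ht']
    have : (inner ℝ (a * v) (a⁻¹ * x) : ℝ) = inner ℝ v x := by
      simp; field_simp
    rw [this, smul_eq_mul, smul_eq_mul]; ring
  simp_rw [h5]
  rw [integral_const_mul, h4, abs_of_pos (inv_pos.2 ha), Complex.real_smul, ← mul_assoc,
    ← Complex.ofReal_mul]
  congr 2
  rw [Real.sqrt_inv]
  have := Real.mul_self_sqrt ha.le
  have h6 := (Real.sqrt_pos.2 ha).ne'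
  field_simp
  nlinarith

theorem fourierHat_translation (α : ℝ) (f : L2R) :
    fourierHat (translation α f) = mulOp (expo α) (unitBounded_expo α) (fourierHat f) := by
  have hp := one_div_pos.2 Real.two_pi_pos
  rw [fourierHat, fourier_translation]
  apply Lp.ext
  filter_upwards [scale_coeFn _ hp (mulOp (expo (α * (2 * Real.pi))) (unitBounded_expo _) (𝓕 f)),
    ae_comp_scale hp (mulOp_coeFn (expo (α * (2 * Real.pi))) (unitBounded_expo _) (𝓕 f)),
    mulOp_coeFn (expo α) (unitBounded_expo α) (fourierHat f), scale_coeFn _ hp (𝓕 f)]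
    with x h1 h2 h3 h4
  rw [h1, h2, h3, fourierHat, h4, expo_mul_left, ← mul_assoc (2 * Real.pi),
    mul_one_div_cancel Real.two_pi_pos.ne', one_mul]
  ring

theorem fourierHat_scale (a : ℝ) (ha : 0 < a) (f : L2R) :
    fourierHat (scale a ha f) = scale a⁻¹ (inv_pos.2 ha) (fourierHat f) := by
  rw [fourierHat, fourierHat, fourier_scale, scale_scale, scale_scale]
  exact scale_congr _ _ (mul_comm _ _) _

theorem dilation_zpow (n : ℤ) (f : L2R) :
    (dilation ^ n) f = scale ((2 : ℝ) ^ n) (zpow_pos two_pos n) f := by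
  induction n generalizing f with
  | zero =>
    rw [zpow_zero, LinearIsometryEquiv.coe_one, id, scale_congr _ one_pos (zpow_zero 2), scale_one]
  | succ n ih =>
    rw [zpow_add_one, LinearIsometryEquiv.coe_mul, Function.comp_apply, ih, dilation, scale_scale]
    exact scale_congr _ _ (zpow_add_one₀ two_ne_zero _).symm _
  | pred n ih =>
    rw [zpow_sub_one, LinearIsometryEquiv.coe_mul, Function.comp_apply, ih]
    have h : (dilation⁻¹ : L2R ≃ₗᵢ[ℂ] L2R) f = scale 2⁻¹ (inv_pos.2 two_pos) f := rfl
    rw [h, scale_scale]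
    exact scale_congr _ _ (zpow_sub_one₀ two_ne_zero _).symm _

/-- The affine system on the Fourier side. -/
theorem fourierHat_affine (ψ : L2R) (n l : ℤ) :
    fourierHat (affine ψ n l) = scale ((2 : ℝ) ^ (-n)) (zpow_pos two_pos _)
      (mulOp (expo l) (unitBounded_expo l) (fourierHat ψ)) := by
  rw [affine, dilation_zpow, fourierHat_scale, fourierHat_translation]
  exact scale_congr _ _ (zpow_neg _ _).symm _

/-! ### Tiles for dyadic dilations and `2π`-translations -/

/-- The sets `2ⁿ W`, `n ∈ ℤ`, partition `ℝ ∖ {0}`. -/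
structure IsDyadicTile (W : Set ℝ) : Prop where
  zero_notMem : (0 : ℝ) ∉ W
  existsUnique : ∀ x : ℝ, x ≠ 0 → ∃! n : ℤ, (2 : ℝ) ^ n * x ∈ W

/-- The sets `W + 2πn`, `n ∈ ℤ`, partition `ℝ`. -/
def IsTranslationTile (W : Set ℝ) : Prop :=
  ∀ x : ℝ, ∃! n : ℤ, x + 2 * n * Real.pi ∈ W

theorem IsDyadicTile.eq_of_mem {W : Set ℝ} (hW : IsDyadicTile W) {x : ℝ} {m n : ℤ}
    (hm : (2 : ℝ) ^ m * x ∈ W) (hn : (2 : ℝ) ^ n * x ∈ W) : m = n := by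
  have hx : x ≠ 0 := by
    rintro rfl
    exact hW.zero_notMem (by simpa using hm)
  exact (hW.existsUnique x hx).unique hm hn

instance fact_two_pi_pos : Fact (0 < 2 * Real.pi) := ⟨Real.two_pi_pos⟩

theorem IsTranslationTile.isAddFundamentalDomain {W : Set ℝ} (hW : IsTranslationTile W)
    (hm : MeasurableSet W) :
    IsAddFundamentalDomain (AddSubgroup.op <| .zmultiples (2 * Real.pi)) W volume := by
  refine IsAddFundamentalDomain.mk' hm.nullMeasurableSet fun x => ?_
  have : Function.Bijective (Set.codRestrict (fun n : ℤ => n • (2 * Real.pi))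
      (AddSubgroup.zmultiples (2 * Real.pi)) fun n => ⟨n, rfl⟩) :=
    (Equiv.ofInjective (fun n : ℤ => n • (2 * Real.pi))
      (zsmul_left_strictMono Real.two_pi_pos).injective).bijective
  refine (AddSubgroup.equivOp _).bijective.comp this |>.existsUnique_iff.2 ?_
  have h2 : ∀ n : ℤ, ((n : ℝ) * (2 * Real.pi)) = 2 * n * Real.pi := fun n => by ring
  simpa [h2] using! hW x

/-- A tile is a fundamental domain for $2\pi\mathbb Z$, however scattered its pieces; this transfers
Fourier series on the circle to $L^2(W)$. -/
theorem IsTranslationTile.measurePreserving_mk {W : Set ℝ} (hW : IsTranslationTile W)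
    (hm : MeasurableSet W) :
    MeasurePreserving ((↑) : ℝ → AddCircle (2 * Real.pi)) (volume.restrict W) volume :=
  measurePreserving_quotientAddGroup_mk_of_AddQuotientMeasureEqMeasurePreimage
    volume (hW.isAddFundamentalDomain hm) _

theorem IsTranslationTile.volume_eq {W : Set ℝ} (hW : IsTranslationTile W)
    (hm : MeasurableSet W) : volume W = ENNReal.ofReal (2 * Real.pi) := by
  have h := (hW.measurePreserving_mk hm).measure_preimage MeasurableSet.univ.nullMeasurableSet
  simpa using h

theorem IsTranslationTile.injective {W : Set ℝ} (hW : IsTranslationTile W) :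
    Function.Injective fun x : W => ((x : ℝ) : AddCircle (2 * Real.pi)) := by
  rintro ⟨x, hx⟩ ⟨y, hy⟩ h
  have h' : ((x : ℝ) : AddCircle (2 * Real.pi)) = y := h
  rw [← sub_eq_zero, ← AddCircle.coe_sub, AddCircle.coe_eq_zero_iff] at h'
  obtain ⟨n, hn⟩ := h'
  rw [zsmul_eq_mul] at hn
  have h1 : n = 0 := (hW y).unique (by convert hx using 1; linarith) (by simpa using hy)
  rw [h1] at hn
  ext
  push_cast at hn
  linarith

theorem fourier_neg_coe (n : ℤ) (x : ℝ) :
    fourier (-n) (x : AddCircle (2 * Real.pi)) = expo n x := by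
  rw [fourier_coe_apply, expo]
  congr 1
  have := Real.pi_ne_zero
  push_cast
  field_simp

/-- Projected to the circle, the integral is a Fourier coefficient of the constant function; the
factor $2\pi$ undoes the normalisation of Haar measure. -/
theorem IsTranslationTile.setIntegral_expo {W : Set ℝ} (hW : IsTranslationTile W)
    (hm : MeasurableSet W) (n : ℤ) :
    ∫ x in W, expo n x = if n = 0 then ((2 * Real.pi : ℝ) : ℂ) else 0 := by
  have h1 : ∫ x in W, expo n x = ∫ t : AddCircle (2 * Real.pi), fourier (-n) t := by
    rw [← (hW.measurePreserving_mk hm).map_eq, integral_map (by fun_prop)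
      (map_continuous _).aestronglyMeasurable]
    simp_rw [fourier_neg_coe]
  have h2 := congrFun (fourierCoeff_fourier (T := 2 * Real.pi) 0) n
  simp only [fourierCoeff, AddCircle.integral_haarAddCircle, fourier_zero, smul_eq_mul, mul_one,
    Pi.single_apply] at h2
  rw [h1]
  have h3 := congrArg (fun z : ℂ => (2 * Real.pi) • z) h2
  simp only [smul_inv_smul₀ Real.two_pi_pos.ne'] at h3
  rw [h3]
  split_ifs <;> simp

/-- Completeness of the exponentials on $W$: `g` restricted to $W$ descends to a function on the
circle, all of whose Fourier coefficients vanish. -/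
theorem IsTranslationTile.ae_eq_zero {W : Set ℝ} (hW : IsTranslationTile W)
    (hm : MeasurableSet W) (g : L2R) (hg : ∀ l : ℤ, ∫ x in W, expo l x * g x = 0) :
    ∀ᵐ x : ℝ, x ∈ W → g x = 0 := by
  have hmp := hW.measurePreserving_mk hm
  have : StandardBorelSpace W := hm.standardBorel
  -- An injective measurable map out of a standard Borel space is a measurable embedding, so the
  -- extension by zero below is measurable.
  have hemb : MeasurableEmbedding fun x : W => ((x : ℝ) : AddCircle (2 * Real.pi)) :=
    Measurable.measurableEmbedding (AddCircle.measurable_mk'.comp measurable_subtype_coe)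
      hW.injective
  set G : AddCircle (2 * Real.pi) → ℂ := Function.extend
    (fun x : W => ((x : ℝ) : AddCircle (2 * Real.pi))) (fun x : W => g x) 0 with hG
  have hGm : Measurable G := hemb.measurable_extend
    ((Lp.stronglyMeasurable g).measurable.comp measurable_subtype_coe) measurable_const
  have hGW : ∀ x ∈ W, G (x : AddCircle (2 * Real.pi)) = g x := fun x hx =>
    hW.injective.extend_apply (fun x : W => g x) 0 ⟨x, hx⟩
  have hLp : MemLp G 2 volume := by
    rw [← hmp.map_eq, memLp_map_measure_iff hGm.aestronglyMeasurable hmp.aemeasurable]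
    refine ((Lp.memLp g).restrict W).ae_eq ?_
    filter_upwards [ae_restrict_mem hm] with x hx
    exact (hGW x hx).symm
  have hLp' : MemLp G 2 AddCircle.haarAddCircle := memLp_haarAddCircle_iff.2 hLp
  have hcoef : ∀ n, fourierCoeff G n = 0 := fun n => by
    rw [fourierCoeff, AddCircle.integral_haarAddCircle, ← hmp.map_eq, integral_map
      (f := fun t => fourier (-n) t • G t) (by fun_prop)
      ((map_continuous (fourier (-n))).measurable.smul hGm).aestronglyMeasurable,
      setIntegral_congr_fun hm (g := fun x => expo n x * g x)
      (fun x hx => by simp only [fourier_neg_coe, hGW x hx, smul_eq_mul]), hg, smul_zero]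
  have hzero : hLp'.toLp G = 0 := by
    apply (fourierBasis (T := 2 * Real.pi)).repr.injective
    ext i
    rw [fourierBasis_repr, fourierCoeff_congr_ae hLp'.coeFn_toLp, hcoef]
    simp
  have hae : ∀ᵐ t : AddCircle (2 * Real.pi), G t = 0 := by
    rw [AddCircle.volume_eq_smul_haarAddCircle]
    refine Measure.ae_smul_measure ?_ _
    have h1 := hLp'.coeFn_toLp
    rw [hzero] at h1
    filter_upwards [h1, Lp.coeFn_zero ℂ 2 AddCircle.haarAddCircle] with t h1 h2
    rw [← h1, h2]; rfl
  rw [← ae_restrict_iff' hm]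
  filter_upwards [hmp.quasiMeasurePreserving.ae hae, ae_restrict_mem hm] with x h1 h2
  rw [← hGW x h2, h1]

/-! ### Minimally supported frequency wavelets -/

theorem fourierHat_affine_coeFn (ψ : L2R) (n l : ℤ) :
    fourierHat (affine ψ n l) =ᵐ[volume] fun x => (Real.sqrt ((2 : ℝ) ^ (-n)) : ℂ) *
      (expo l ((2 : ℝ) ^ (-n) * x) * fourierHat ψ ((2 : ℝ) ^ (-n) * x)) := by
  rw [fourierHat_affine]
  filter_upwards [scale_coeFn _ (zpow_pos two_pos (-n)) (mulOp (expo l) (unitBounded_expo l)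
    (fourierHat ψ)), ae_comp_scale (zpow_pos two_pos (-n)) (mulOp_coeFn _ (unitBounded_expo l)
    (fourierHat ψ))] with x h1 h2
  rw [h1, h2]

theorem conj_expo (α x : ℝ) : conj (expo α x) = expo (-α) x := by
  rw [expo, expo, ← Complex.exp_conj]
  simp

theorem expo_add_left (α β x : ℝ) : expo (α + β) x = expo α x * expo β x := by
  rw [expo, expo, expo, ← Complex.exp_add]; push_cast; ring_nf

theorem inner_fourierHat (f g : L2R) : inner ℂ (fourierHat f) (fourierHat g) = inner ℂ f g :=
  fourierEquivL2.inner_map_map f g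

theorem inner_eq_zero_of_ae {f g : L2R} (h : ∀ᵐ x : ℝ, f x = 0 ∨ g x = 0) :
    inner ℂ f g = 0 := by
  rw [L2.inner_def]
  refine integral_eq_zero_of_ae ?_
  filter_upwards [h] with x hx
  rcases hx with hx | hx <;> simp [hx]

/-- The constant `(2π)^(-1/2)`. -/
def msfConst : ℂ := (((Real.sqrt (2 * Real.pi))⁻¹ : ℝ) : ℂ)

theorem msfConst_ne_zero : msfConst ≠ 0 := by
  rw [msfConst, Complex.ofReal_ne_zero]
  exact inv_ne_zero (Real.sqrt_pos.2 Real.two_pi_pos).ne'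

theorem conj_msfConst : conj msfConst = msfConst := Complex.conj_ofReal _

theorem msfConst_mul_self : msfConst * msfConst * ((2 * Real.pi : ℝ) : ℂ) = 1 := by
  rw [msfConst, ← Complex.ofReal_mul, ← Complex.ofReal_mul, ← mul_inv,
    Real.mul_self_sqrt Real.two_pi_pos.le, inv_mul_cancel₀ Real.two_pi_pos.ne', Complex.ofReal_one]

/-- At equal scales the dilation is unitary and drops out, leaving orthogonality of exponentials on
$W$; at different scales the supports $2^nW$ and $2^{n'}W$ are disjoint. -/
theorem orthonormal_affine_msf {W : Set ℝ} (hm : MeasurableSet W) (hd : IsDyadicTile W)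
    (ht : IsTranslationTile W) {ψ : L2R}
    (hψ : fourierHat ψ =ᵐ[volume] W.indicator fun _ => msfConst) :
    Orthonormal ℂ (fun p : ℤ × ℤ => affine ψ p.1 p.2) := by
  rw [orthonormal_iff_ite]
  rintro ⟨n, l⟩ ⟨n', l'⟩
  rw [← inner_fourierHat]
  by_cases hn : n = n'
  · subst hn
    simp only [fourierHat_affine, LinearIsometryEquiv.inner_map_map, Prod.mk.injEq, true_and]
    have h1 : ∀ᵐ x, inner ℂ (mulOp (expo l) (unitBounded_expo l) (fourierHat ψ) x)
        (mulOp (expo l') (unitBounded_expo l') (fourierHat ψ) x) =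
        W.indicator (fun x => msfConst * msfConst * expo ((l' - l : ℤ) : ℝ) x) x := by
      filter_upwards [mulOp_coeFn _ (unitBounded_expo l) (fourierHat ψ),
        mulOp_coeFn _ (unitBounded_expo l') (fourierHat ψ), hψ] with x h1 h2 h3
      rw [h1, h2, h3]
      by_cases hx : x ∈ W
      · rw [Set.indicator_of_mem hx, Set.indicator_of_mem hx, RCLike.inner_apply, map_mul,
          conj_expo, conj_msfConst, Int.cast_sub, sub_eq_add_neg, expo_add_left]
        ring
      · simp [hx]
    rw [L2.inner_def, integral_congr_ae h1, integral_indicator hm, integral_const_mul,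
      ht.setIntegral_expo hm, mul_ite, msfConst_mul_self, mul_zero]
    simp only [sub_eq_zero, eq_comm]
  · rw [if_neg (by simp [hn])]
    apply inner_eq_zero_of_ae
    filter_upwards [fourierHat_affine_coeFn ψ n l, fourierHat_affine_coeFn ψ n' l',
      ae_comp_scale (zpow_pos two_pos (-n)) hψ, ae_comp_scale (zpow_pos two_pos (-n')) hψ]
      with x h1 h2 h3 h4
    simp only [h1, h2, h3, h4]
    by_cases hx : (2 : ℝ) ^ (-n) * x ∈ W
    · by_cases hx' : (2 : ℝ) ^ (-n') * x ∈ W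
      · exact absurd (neg_injective (hd.eq_of_mem hx hx')) hn
      · right; rw [Set.indicator_of_notMem hx', mul_zero, mul_zero]
    · left; rw [Set.indicator_of_notMem hx, mul_zero, mul_zero]

/-- Moving the dilation onto `g` lets orthogonality at every scale be tested on the one set $W$. -/
theorem inner_affine_eq_zero_iff {ψ g : L2R} (n l : ℤ) :
    inner ℂ (affine ψ n l) g = 0 ↔ inner ℂ (mulOp (expo l) (unitBounded_expo l) (fourierHat ψ))
      (scale ((2 : ℝ) ^ n) (zpow_pos two_pos n) (fourierHat g)) = 0 := by
  rw [← inner_fourierHat, fourierHat_affine, ← (scale ((2 : ℝ) ^ n) (zpow_pos two_pos n)).inner_map_map,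
    scale_scale, scale_congr _ one_pos (by rw [← zpow_add₀ two_ne_zero]; simp), scale_one]

theorem IsDyadicTile.ae_of_forall {W : Set ℝ} (hd : IsDyadicTile W) {p : ℝ → Prop}
    (h : ∀ n : ℤ, ∀ᵐ x : ℝ, x ∈ W → p ((2 : ℝ) ^ n * x)) : ∀ᵐ x, p x := by
  have h0 : ∀ᵐ x : ℝ, x ≠ 0 := by simp [ae_iff]
  have h1 : ∀ n : ℤ, ∀ᵐ x : ℝ, (2 : ℝ) ^ (-n) * x ∈ W → p x := fun n => by
    filter_upwards [ae_comp_scale (zpow_pos two_pos (-n)) (h n)] with x hx hxW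
    have := hx hxW
    rwa [← mul_assoc, ← zpow_add₀ two_ne_zero, add_neg_cancel, zpow_zero, one_mul] at this
  filter_upwards [h0, ae_all_iff.2 h1] with x hx0 hx
  obtain ⟨n, hn, -⟩ := hd.existsUnique x hx0
  exact hx (-n) (by rwa [neg_neg])

/-- For totality, a function orthogonal to the system has every dilate of its transform vanishing on
$W$ by completeness of the exponentials, and the dilates of $W$ cover the line up to the origin. -/
theorem isWavelet_msf {W : Set ℝ} (hm : MeasurableSet W) (hd : IsDyadicTile W)
    (ht : IsTranslationTile W) {ψ : L2R}
    (hψ : fourierHat ψ =ᵐ[volume] W.indicator fun _ => msfConst) : IsWavelet ψ := by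
  refine ⟨orthonormal_affine_msf hm hd ht hψ, ?_⟩
  rw [Submodule.topologicalClosure_eq_top_iff, Submodule.eq_bot_iff]
  intro g hg
  have h1 : ∀ n l : ℤ, inner ℂ (affine ψ n l) g = 0 := fun n l =>
    (Submodule.mem_orthogonal _ _).1 hg _ (Submodule.subset_span ⟨(n, l), rfl⟩)
  have h2 : ∀ n : ℤ, ∀ᵐ x : ℝ, x ∈ W →
      scale ((2 : ℝ) ^ n) (zpow_pos two_pos n) (fourierHat g) x = 0 := fun n => by
    apply ht.ae_eq_zero hm
    intro l
    have h3 := (inner_affine_eq_zero_iff n (-l)).1 (h1 n (-l))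
    rw [L2.inner_def] at h3
    have h4 : ∀ᵐ x, inner ℂ (mulOp (expo (-l : ℤ)) (unitBounded_expo _) (fourierHat ψ) x)
        (scale ((2 : ℝ) ^ n) (zpow_pos two_pos n) (fourierHat g) x) =
        W.indicator (fun x => msfConst * (expo l x *
          scale ((2 : ℝ) ^ n) (zpow_pos two_pos n) (fourierHat g) x)) x := by
      filter_upwards [mulOp_coeFn _ (unitBounded_expo (-l : ℤ)) (fourierHat ψ), hψ] with x h1 h3
      rw [h1, h3]
      by_cases hx : x ∈ W
      · rw [Set.indicator_of_mem hx, Set.indicator_of_mem hx, RCLike.inner_apply, map_mul,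
          conj_expo, conj_msfConst, Int.cast_neg, neg_neg]
        ring
      · simp [hx]
    rw [integral_congr_ae h4, integral_indicator hm, integral_const_mul] at h3
    exact (mul_eq_zero.1 h3).resolve_left msfConst_ne_zero
  have h5 : ∀ᵐ x, fourierHat g x = 0 := by
    apply hd.ae_of_forall
    intro n
    filter_upwards [h2 n, scale_coeFn _ (zpow_pos two_pos n) (fourierHat g)] with x h3 h4 hx
    have h6 := h3 hx
    rw [h4] at h6
    refine (mul_eq_zero.1 h6).resolve_left ?_
    exact Complex.ofReal_ne_zero.2 (Real.sqrt_pos.2 (zpow_pos two_pos n)).ne'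
  have h6 : fourierEquivL2 g = 0 := by
    apply Lp.ext
    filter_upwards [h5, Lp.coeFn_zero ℂ 2 (volume : Measure ℝ)] with x h1 h2
    rw [fourierEquivL2_apply, h1, h2]; rfl
  exact (map_eq_zero_iff _ fourierEquivL2.injective).1 h6

theorem exists_isMSFWavelet {W : Set ℝ} (hm : MeasurableSet W) (hd : IsDyadicTile W)
    (ht : IsTranslationTile W) : ∃ ψ, IsMSFWavelet W ψ := by
  have hv : volume W ≠ ⊤ := by rw [ht.volume_eq hm]; exact ENNReal.ofReal_ne_top
  have h : fourierHat (fourierEquivL2.symm (indicatorConstLp 2 hm hv msfConst)) =ᵐ[volume]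
      W.indicator fun _ => msfConst := by
    rw [← fourierEquivL2_apply, LinearIsometryEquiv.apply_symm_apply]
    exact indicatorConstLp_coeFn
  exact ⟨_, hm, h, isWavelet_msf hm hd ht h⟩

/-! ### Operator interpolation -/

/-- Composition with a measure preserving map, as an operator on `L²(ℝ)`. -/
def compOp (σ : ℝ → ℝ) (hσ : MeasurePreserving σ volume volume) : L2R →ₗᵢ[ℂ] L2R :=
  Lp.compMeasurePreservingₗᵢ ℂ σ hσ

theorem compOp_coeFn {σ : ℝ → ℝ} (hσ : MeasurePreserving σ volume volume) (f : L2R) :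
    compOp σ hσ f =ᵐ[volume] fun x => f (σ x) :=
  Lp.coeFn_compMeasurePreserving f hσ

/-- The operator `f ↦ u f + v (f ∘ σ)`. -/
def interpOp (u v : ℝ → ℂ) (hu : UnitBounded u) (hv : UnitBounded v) (σ : ℝ → ℝ)
    (hσ : MeasurePreserving σ volume volume) : L2R →L[ℂ] L2R :=
  mulOp u hu + (mulOp v hv).comp (compOp σ hσ).toContinuousLinearMap

theorem interpOp_coeFn {u v : ℝ → ℂ} (hu : UnitBounded u) (hv : UnitBounded v) {σ : ℝ → ℝ}
    (hσ : MeasurePreserving σ volume volume) (f : L2R) :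
    interpOp u v hu hv σ hσ f =ᵐ[volume] fun x => u x * f x + v x * f (σ x) := by
  have h : interpOp u v hu hv σ hσ f = mulOp u hu f + mulOp v hv (compOp σ hσ f) := rfl
  rw [h]
  filter_upwards [Lp.coeFn_add (mulOp u hu f) (mulOp v hv (compOp σ hσ f)), mulOp_coeFn u hu f,
    mulOp_coeFn v hv (compOp σ hσ f), compOp_coeFn hσ f] with x h1 h2 h3 h4
  rw [h1, Pi.add_apply, h2, h3, h4]

theorem inner_mulOp_left {u : ℝ → ℂ} (hu : UnitBounded u) (f g : L2R) :
    inner ℂ (mulOp u hu f) g = inner ℂ f (mulOp _ hu.conj g) := by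
  rw [L2.inner_def, L2.inner_def]
  refine integral_congr_ae ?_
  filter_upwards [mulOp_coeFn u hu f, mulOp_coeFn _ hu.conj g] with x h1 h2
  rw [h1, h2, RCLike.inner_apply, RCLike.inner_apply, map_mul]
  ring

theorem compOp_compOp {σ : ℝ → ℝ} (hσ : MeasurePreserving σ volume volume)
    (hi : Function.Involutive σ) (f : L2R) : compOp σ hσ (compOp σ hσ f) = f := by
  apply Lp.ext
  filter_upwards [compOp_coeFn hσ (compOp σ hσ f),
    hσ.quasiMeasurePreserving.ae (compOp_coeFn hσ f)] with x h1 h2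
  rw [h1, h2, hi]

/-- Composition with an involutive measure preserving map is self-adjoint. Taking the adjoint
reverses the order of multiplication and composition, hence the weight $\bar v\circ\sigma$. -/
theorem inner_interpOp_left {u v : ℝ → ℂ} (hu : UnitBounded u) (hv : UnitBounded v) {σ : ℝ → ℝ}
    (hσ : MeasurePreserving σ volume volume) (hi : Function.Involutive σ) (f g : L2R) :
    inner ℂ (interpOp u v hu hv σ hσ f) g =
      inner ℂ f (interpOp _ _ hu.conj (hv.conj.comp hσ.measurable) σ hσ g) := by
  have h : interpOp u v hu hv σ hσ f = mulOp u hu f + mulOp v hv (compOp σ hσ f) := rfl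
  have h' : interpOp _ _ hu.conj (hv.conj.comp hσ.measurable) σ hσ g =
      mulOp _ hu.conj g + compOp σ hσ (mulOp _ hv.conj g) := by
    apply Lp.ext
    filter_upwards [Lp.coeFn_add (mulOp _ hu.conj g) (compOp σ hσ (mulOp _ hv.conj g)),
      interpOp_coeFn hu.conj (hv.conj.comp hσ.measurable) hσ g,
      mulOp_coeFn _ hu.conj g, compOp_coeFn hσ (mulOp _ hv.conj g),
      hσ.quasiMeasurePreserving.ae (mulOp_coeFn _ hv.conj g)] with x h1 h2 h3 h4 h5
    rw [h1, Pi.add_apply, h2, h3, h4, h5]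
  rw [h, h', inner_add_left, inner_add_right, inner_mulOp_left, inner_mulOp_left,
    ← (compOp σ hσ).inner_map_map (compOp σ hσ f), compOp_compOp hσ hi]

/-- A tile `W` for dyadic dilations and `2π`-translations, with an involutive measure preserving
2-homogeneous map `σ` that is a `2π`-translation congruence on `W`, and 2-dilation periodic
coefficients `h₁`, `h₂` whose interpolation matrix is unitary. -/
structure InterpolationData (W : Set ℝ) (σ : ℝ → ℝ) (h₁ h₂ : ℝ → ℂ) : Prop where
  measurableSet : MeasurableSet W
  dyadicTile : IsDyadicTile W
  translationTile : IsTranslationTile W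
  involutive : Function.Involutive σ
  measurePreserving : MeasurePreserving σ volume volume
  homogeneous : ∀ x, σ (2 * x) = 2 * σ x
  congruence : ∀ x ∈ W, ∃ k : ℤ, σ x = x + 2 * k * Real.pi
  unit₁ : UnitBounded h₁
  unit₂ : UnitBounded h₂
  periodic₁ : ∀ x, h₁ (2 * x) = h₁ x
  periodic₂ : ∀ x, h₂ (2 * x) = h₂ x
  unitary : ∀ x, !![h₁ x, h₂ x; h₂ (σ x), h₁ (σ x)] ∈ Matrix.unitaryGroup (Fin 2) ℂ

/-- The data of a minimally supported frequency wavelet. -/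
theorem InterpolationData.msf {W : Set ℝ} (hm : MeasurableSet W) (hd : IsDyadicTile W)
    (ht : IsTranslationTile W) : InterpolationData W id (fun _ => 1) fun _ => 0 where
  measurableSet := hm
  dyadicTile := hd
  translationTile := ht
  involutive _ := rfl
  measurePreserving := MeasurePreserving.id _
  homogeneous _ := rfl
  congruence x _ := ⟨0, by simp⟩
  unit₁ := ⟨measurable_const, by simp⟩
  unit₂ := ⟨measurable_const, by simp⟩
  periodic₁ _ := rfl
  periodic₂ _ := rfl
  unitary _ := by
    rw [Matrix.mem_unitaryGroup_iff]
    ext i j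
    fin_cases i <;> fin_cases j <;> simp [Matrix.mul_apply, Matrix.star_apply]

theorem apply_two_zpow_mul {f : ℝ → ℂ} (hf : ∀ x, f (2 * x) = f x) (n : ℤ) (x : ℝ) :
    f ((2 : ℝ) ^ n * x) = f x := by
  induction n with
  | zero => simp
  | succ n ih => rw [zpow_add_one₀ two_ne_zero, mul_right_comm, mul_comm, hf, ih]
  | pred n ih => rw [← hf, ← mul_assoc, ← zpow_one_add₀ two_ne_zero, add_sub_cancel, ih]

theorem map_two_zpow_mul {σ : ℝ → ℝ} (hσ : ∀ x, σ (2 * x) = 2 * σ x) (n : ℤ) (x : ℝ) :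
    σ ((2 : ℝ) ^ n * x) = (2 : ℝ) ^ n * σ x := by
  induction n with
  | zero => simp
  | succ n ih =>
    rw [zpow_add_one₀ two_ne_zero, mul_right_comm, mul_comm, hσ, ih]; ring
  | pred n ih =>
    have h := hσ ((2 : ℝ) ^ (-(n : ℤ) - 1) * x)
    rw [← mul_assoc, ← zpow_one_add₀ two_ne_zero, add_sub_cancel, ih] at h
    rw [zpow_sub_one₀ two_ne_zero] at h ⊢
    linarith

/-- Split `f` along the closed span of the `e i` with `i ∈ s`. The orthogonal part is orthogonal to
those vectors by construction and to the others because both `f` and its projection are; totality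
kills it. -/
theorem orthogonal_system_mem_closure {H ι : Type*} [NormedAddCommGroup H] [InnerProductSpace ℂ H]
    [CompleteSpace H] {e : ι → H} (he : Orthonormal ℂ e)
    (htop : (Submodule.span ℂ (Set.range e)).topologicalClosure = ⊤) (s : Set ι) {f : H}
    (hf : ∀ i ∉ s, inner ℂ (e i) f = 0) :
    f ∈ (Submodule.span ℂ (e '' s)).topologicalClosure := by
  set K := (Submodule.span ℂ (e '' s)).topologicalClosure
  have hKc : IsClosed (K : Set H) := Submodule.isClosed_topologicalClosure _
  have : CompleteSpace K := hKc.completeSpace_coe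
  obtain ⟨y, hy, z, hz, rfl⟩ := K.exists_add_mem_mem_orthogonal f
  have hKe : ∀ i ∈ s, e i ∈ K := fun i hi =>
    Submodule.le_topologicalClosure _ (Submodule.subset_span ⟨i, hi, rfl⟩)
  have hy' : ∀ i ∉ s, inner ℂ (e i) y = 0 := fun i hi => by
    have : K ≤ (LinearMap.ker (innerSL ℂ (e i)).toLinearMap) := by
      apply Submodule.topologicalClosure_minimal
      · rw [Submodule.span_le]
        rintro _ ⟨k, hk, rfl⟩
        exact he.2 (fun h => hi (h ▸ hk))
      · exact (innerSL ℂ (e i)).isClosed_ker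
    exact this hy
  have hz0 : z ∈ (Submodule.span ℂ (Set.range e))ᗮ := by
    rw [Submodule.mem_orthogonal]
    intro u hu
    induction hu using Submodule.span_induction with
    | mem u hu =>
      obtain ⟨i, rfl⟩ := hu
      by_cases hi : i ∈ s
      · exact (Submodule.mem_orthogonal _ _).1 hz _ (hKe i hi)
      · have := hf i hi
        rwa [inner_add_right, hy' i hi, zero_add] at this
    | zero => simp
    | add u v _ _ hu hv => rw [inner_add_left, hu, hv, add_zero]
    | smul c u _ hu => rw [inner_smul_left, hu, mul_zero]
  rw [Submodule.topologicalClosure_eq_top_iff.1 htop, Submodule.mem_bot] at hz0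
  rwa [hz0, add_zero]


/-- The set of all `2ⁿ x` with `x ∈ W` and `n ≥ 0`. -/
def dilates (W : Set ℝ) : Set ℝ := {x | ∃ n : ℕ, (2 : ℝ) ^ (-(n : ℤ)) * x ∈ W}

theorem measurableSet_dilates {W : Set ℝ} (hW : MeasurableSet W) : MeasurableSet (dilates W) := by
  have : dilates W = ⋃ n : ℕ, (fun x : ℝ => (2 : ℝ) ^ (-(n : ℤ)) * x) ⁻¹' W := by
    ext x; simp [dilates]
  rw [this]
  exact MeasurableSet.iUnion fun n => (measurable_const_mul _) hW

theorem subset_dilates (W : Set ℝ) : W ⊆ dilates W := fun x hx => ⟨0, by simpa using hx⟩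

/-! ### Wavelets and core spaces obtained from a unitary interpolation operator -/

namespace InterpolationData

variable {W : Set ℝ} {σ : ℝ → ℝ} {h₁ h₂ : ℝ → ℂ} (D : InterpolationData W σ h₁ h₂)

include D

theorem star_mul (x : ℝ) : conj (h₁ x) * h₁ x + conj (h₂ (σ x)) * h₂ (σ x) = 1 ∧
    conj (h₁ x) * h₂ x + conj (h₂ (σ x)) * h₁ (σ x) = 0 := by
  have h := Matrix.mem_unitaryGroup_iff'.1 (D.unitary x)
  have h1 := congrFun (congrFun h 0) 0
  have h2 := congrFun (congrFun h 0) 1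
  simpa [Matrix.mul_apply, Matrix.star_apply] using And.intro h1 h2

theorem mul_star (x : ℝ) : h₁ x * conj (h₁ x) + h₂ x * conj (h₂ x) = 1 ∧
    h₁ x * conj (h₂ (σ x)) + h₂ x * conj (h₁ (σ x)) = 0 := by
  have h := Matrix.mem_unitaryGroup_iff.1 (D.unitary x)
  have h1 := congrFun (congrFun h 0) 0
  have h2 := congrFun (congrFun h 0) 1
  simpa [Matrix.mul_apply, Matrix.star_apply] using And.intro h1 h2

/-- The interpolation operator `f ↦ h₁ f + h₂ (f ∘ σ)`. -/
def op : L2R →L[ℂ] L2R := interpOp h₁ h₂ D.unit₁ D.unit₂ σ D.measurePreserving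

/-- The inverse of the interpolation operator. -/
def inv : L2R →L[ℂ] L2R := interpOp _ _ D.unit₁.conj
  (D.unit₂.conj.comp D.measurePreserving.measurable) σ D.measurePreserving

theorem op_coeFn (f : L2R) : D.op f =ᵐ[volume] fun x => h₁ x * f x + h₂ x * f (σ x) :=
  interpOp_coeFn _ _ _ _

theorem inv_coeFn (f : L2R) :
    D.inv f =ᵐ[volume] fun x => conj (h₁ x) * f x + conj (h₂ (σ x)) * f (σ x) :=
  interpOp_coeFn _ _ _ _

theorem inner_op_left (f g : L2R) : inner ℂ (D.op f) g = inner ℂ f (D.inv g) :=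
  inner_interpOp_left _ _ _ D.involutive _ _

theorem inv_op (f : L2R) : D.inv (D.op f) = f := by
  apply Lp.ext
  filter_upwards [D.inv_coeFn (D.op f), D.op_coeFn f,
    D.measurePreserving.quasiMeasurePreserving.ae (D.op_coeFn f)] with x h1 h2 h3
  rw [h1, h2, h3, D.involutive]
  linear_combination f x * (D.star_mul x).1 + f (σ x) * (D.star_mul x).2

theorem op_inv (f : L2R) : D.op (D.inv f) = f := by
  apply Lp.ext
  filter_upwards [D.op_coeFn (D.inv f), D.inv_coeFn f,
    D.measurePreserving.quasiMeasurePreserving.ae (D.inv_coeFn f)] with x h1 h2 h3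
  rw [h1, h2, h3, D.involutive]
  linear_combination f x * (D.mul_star x).1 + f (σ x) * (D.mul_star x).2

variable {ψ₁ ψ : L2R} (hψ₁ : fourierHat ψ₁ =ᵐ[volume] W.indicator fun _ => msfConst)
  (hψ : fourierHat ψ = D.op (fourierHat ψ₁))

include hψ₁ hψ

/-- Dilations commute with the interpolation operator because $\sigma$ is homogeneous and the
coefficients are dilation periodic; modulations by integers pass through because $\sigma$ moves
points of $W$ by multiples of $2\pi$. -/
theorem fourierHat_affine_eq (n l : ℤ) :
    fourierHat (affine ψ n l) = D.op (fourierHat (affine ψ₁ n l)) := by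
  apply Lp.ext
  have h0 := zpow_pos (two_pos : (0 : ℝ) < 2) (-n)
  have hop := D.op_coeFn (fourierHat ψ₁)
  rw [← hψ] at hop
  have hσ := D.measurePreserving.quasiMeasurePreserving
  filter_upwards [fourierHat_affine_coeFn ψ n l, ae_comp_scale h0 hop,
    D.op_coeFn (fourierHat (affine ψ₁ n l)), fourierHat_affine_coeFn ψ₁ n l,
    hσ.ae (fourierHat_affine_coeFn ψ₁ n l), ae_comp_scale h0 (hσ.ae hψ₁)] with x h1 h2 h3 h4 h5 h6
  rw [h1, h2, h3, h4, h5, apply_two_zpow_mul D.periodic₁, apply_two_zpow_mul D.periodic₂]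
  rw [← map_two_zpow_mul D.homogeneous]
  set y := (2 : ℝ) ^ (-n) * x
  -- The congruence holds only on $W$, so it is applied at $\sigma(y)$; off $W$ the factor
  -- $\hat\psi_1(\sigma(y))$ vanishes.
  have h7 : expo l (σ y) * fourierHat ψ₁ (σ y) = expo l y * fourierHat ψ₁ (σ y) := by
    by_cases hy : σ y ∈ W
    · obtain ⟨k, hk⟩ := D.congruence _ hy
      rw [D.involutive] at hk
      conv_rhs => rw [hk, expo_add_right, expo_two_pi _ l rfl, mul_one, ← hk]
    · rw [h6, Set.indicator_of_notMem hy, mul_zero, mul_zero]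
  rw [h7]
  ring

/-- The affine system is the image of that of `ψ₁` under a unitary operator, so orthonormality and
totality are inherited. -/
theorem isWavelet : IsWavelet ψ := by
  have hw := isWavelet_msf D.measurableSet D.dyadicTile D.translationTile hψ₁
  have key : ∀ n l g, inner ℂ (affine ψ n l) g =
      inner ℂ (affine ψ₁ n l) (fourierEquivL2.symm (D.inv (fourierHat g))) := fun n l g => by
    rw [← inner_fourierHat, D.fourierHat_affine_eq hψ₁ hψ, D.inner_op_left,
      ← inner_fourierHat (affine ψ₁ n l), ← fourierEquivL2_apply (fourierEquivL2.symm _), LinearIsometryEquiv.apply_symm_apply]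
  constructor
  · rw [orthonormal_iff_ite]
    intro p q
    rw [key, D.fourierHat_affine_eq hψ₁ hψ, D.inv_op, ← fourierEquivL2_apply,
      LinearIsometryEquiv.symm_apply_apply]
    exact orthonormal_iff_ite.1 hw.1 p q
  · rw [Submodule.topologicalClosure_eq_top_iff, Submodule.eq_bot_iff]
    intro g hg
    have h1 : fourierEquivL2.symm (D.inv (fourierHat g)) ∈
        (Submodule.span ℂ (Set.range fun p : ℤ × ℤ => affine ψ₁ p.1 p.2))ᗮ := by
      rw [Submodule.mem_orthogonal]
      intro u hu
      induction hu using Submodule.span_induction with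
      | mem u hu =>
        obtain ⟨p, rfl⟩ := hu
        rw [← key]
        exact (Submodule.mem_orthogonal _ _).1 hg _ (Submodule.subset_span ⟨p, rfl⟩)
      | zero => simp
      | add u v _ _ hu hv => rw [inner_add_left, hu, hv, add_zero]
      | smul c u _ hu => rw [inner_smul_left, hu, mul_zero]
    rw [Submodule.topologicalClosure_eq_top_iff.1 hw.2, Submodule.mem_bot,
      map_eq_zero_iff _ fourierEquivL2.symm.injective] at h1
    have h2 := D.op_inv (fourierHat g)
    rw [h1, map_zero] at h2
    exact (map_eq_zero_iff _ fourierEquivL2.injective).1 h2.symm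

/-- After applying $U^*$, the generators with $n<0$ live on $2^nW$, disjoint from `dilates W`, and
the condition is closed. Conversely, vanishing on `dilates W` gives orthogonality to every element
with $n\ge0$, which suffices in an orthonormal basis. -/
theorem mem_coreSpace_iff (f : L2R) : f ∈ coreSpace ψ ↔
    ∀ᵐ x, x ∈ dilates W → D.inv (fourierHat f) x = 0 := by
  have hE := unitBounded_indicator (measurableSet_dilates D.measurableSet)
  set A : L2R →L[ℂ] L2R := (mulOp _ hE).comp
    (D.inv.comp fourierEquivL2.toLinearIsometry.toContinuousLinearMap) with hA
  have hA' : ∀ f, A f = mulOp _ hE (D.inv (fourierHat f)) := fun f => rfl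
  have hker : ∀ f, f ∈ LinearMap.ker A.toLinearMap ↔
      ∀ᵐ x, x ∈ dilates W → D.inv (fourierHat f) x = 0 := fun f => by
    have h1 : f ∈ LinearMap.ker A.toLinearMap ↔ mulOp _ hE (D.inv (fourierHat f)) = 0 := by
      rw [← hA']; exact LinearMap.mem_ker
    rw [h1, Lp.eq_zero_iff_ae_eq_zero]
    constructor
    · intro h
      filter_upwards [h, mulOp_coeFn _ hE (D.inv (fourierHat f))] with x h2 h3 hx
      rw [h3] at h2
      simpa [hx] using h2
    · intro h
      filter_upwards [h, mulOp_coeFn _ hE (D.inv (fourierHat f))] with x h2 h3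
      rw [h3]
      by_cases hx : x ∈ dilates W <;> simp [hx, h2]
  constructor
  · intro hf
    rw [← hker]
    refine Submodule.topologicalClosure_minimal _ ?_ A.isClosed_ker hf
    rw [Submodule.span_le]
    rintro _ ⟨n, l, hn, rfl⟩
    rw [SetLike.mem_coe, hker, D.fourierHat_affine_eq hψ₁ hψ, D.inv_op]
    filter_upwards [fourierHat_affine_coeFn ψ₁ n l,
      ae_comp_scale (zpow_pos two_pos (-n)) hψ₁] with x h1 h2 hx
    obtain ⟨k, hk⟩ := hx
    rw [h1, h2, Set.indicator_of_notMem, mul_zero, mul_zero]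
    intro hx
    have := D.dyadicTile.eq_of_mem hx hk
    omega
  · intro hf
    have hw := D.isWavelet hψ₁ hψ
    have hset : {f | ∃ n l : ℤ, n < 0 ∧ f = affine ψ n l} =
        (fun p : ℤ × ℤ => affine ψ p.1 p.2) '' {p | p.1 < 0} := by
      ext g
      constructor
      · rintro ⟨n, l, hn, rfl⟩
        exact ⟨(n, l), hn, rfl⟩
      · rintro ⟨p, hp, rfl⟩
        exact ⟨p.1, p.2, hp, rfl⟩
    rw [coreSpace, hset]
    refine orthogonal_system_mem_closure hw.1 hw.2 _ fun p hp => ?_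
    obtain ⟨n, l⟩ := p
    obtain ⟨k, rfl⟩ := Int.eq_ofNat_of_zero_le (not_lt.1 hp : 0 ≤ n)
    rw [← inner_fourierHat, D.fourierHat_affine_eq hψ₁ hψ, D.inner_op_left]
    apply inner_eq_zero_of_ae
    filter_upwards [fourierHat_affine_coeFn ψ₁ k l,
      ae_comp_scale (zpow_pos two_pos (-(k : ℤ))) hψ₁, hf] with x h1 h2 h3
    by_cases hx : (2 : ℝ) ^ (-(k : ℤ)) * x ∈ W
    · exact Or.inr (h3 ⟨k, hx⟩)
    · left
      rw [h1, h2, Set.indicator_of_notMem hx, mul_zero, mul_zero]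

/-- On `dilates W` a $\sigma$-invariant character factors out of $U^*$, so multiplying by it
preserves the vanishing. -/
theorem translation_mem_coreSpace {α : ℝ} (hα : ∀ x ∈ dilates W, expo α (σ x) = expo α x)
    {f : L2R} (hf : f ∈ coreSpace ψ) : translation α f ∈ coreSpace ψ := by
  rw [D.mem_coreSpace_iff hψ₁ hψ] at hf ⊢
  rw [fourierHat_translation]
  filter_upwards [hf, D.inv_coeFn (fourierHat f),
    D.inv_coeFn (mulOp _ (unitBounded_expo α) (fourierHat f)),
    mulOp_coeFn _ (unitBounded_expo α) (fourierHat f),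
    D.measurePreserving.quasiMeasurePreserving.ae
      (mulOp_coeFn _ (unitBounded_expo α) (fourierHat f))] with x h1 h2 h3 h4 h5 hx
  rw [h3, h4, h5, hα x hx]
  have h6 := h1 hx
  rw [h2] at h6
  linear_combination expo α x * h6

/-- The witness is $\hat f=U\chi_{\sigma(S)}$. Since $\sigma(S)$ avoids `dilates W`, `f` lies in the
core space; modulating before applying $U^*$ leaks onto $S$ with amplitude $\bar
h_1h_2\,(e_\alpha-e_\alpha\circ\sigma)$, where $e_\alpha(\xi)=e^{-i\alpha\xi}$. -/
theorem exists_translation_notMem_coreSpace {α : ℝ} {S : Set ℝ} (hS : MeasurableSet S)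
    (hS0 : volume S ≠ 0) (hSt : volume S ≠ ⊤) (hSW : S ⊆ dilates W)
    (hσS : ∀ x ∈ S, σ x ∉ dilates W) (hS₁ : ∀ x ∈ S, h₁ x ≠ 0) (hS₂ : ∀ x ∈ S, h₂ x ≠ 0)
    (hα : ∀ x ∈ S, expo α (σ x) ≠ expo α x) :
    ∃ f ∈ coreSpace ψ, translation α f ∉ coreSpace ψ := by
  have hB : MeasurableSet (σ ⁻¹' S) := D.measurePreserving.measurable hS
  have hBt : volume (σ ⁻¹' S) ≠ ⊤ := by
    rwa [D.measurePreserving.measure_preimage hS.nullMeasurableSet]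
  set b : L2R := indicatorConstLp 2 hB hBt 1
  have hb : ∀ᵐ x : ℝ, b x = (σ ⁻¹' S).indicator (fun _ => 1) x := indicatorConstLp_coeFn
  have hf : fourierHat (fourierEquivL2.symm (D.op b)) = D.op b := by
    rw [← fourierEquivL2_apply, LinearIsometryEquiv.apply_symm_apply]
  have hσ := D.measurePreserving.quasiMeasurePreserving
  refine ⟨fourierEquivL2.symm (D.op b), ?_, fun hcon => hS0 ?_⟩
  · rw [D.mem_coreSpace_iff hψ₁ hψ, hf, D.inv_op]
    filter_upwards [hb] with x h1 hx
    rw [h1, Set.indicator_of_notMem]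
    intro hx'
    exact hσS _ hx' (by rwa [D.involutive])
  · rw [D.mem_coreSpace_iff hψ₁ hψ, fourierHat_translation, hf] at hcon
    suffices h : ∀ᵐ x : ℝ, x ∉ S by simpa [ae_iff] using h
    filter_upwards [hcon, D.inv_coeFn (mulOp _ (unitBounded_expo α) (D.op b)),
      mulOp_coeFn _ (unitBounded_expo α) (D.op b),
      hσ.ae (mulOp_coeFn _ (unitBounded_expo α) (D.op b)), D.op_coeFn b, hσ.ae (D.op_coeFn b),
      hb, hσ.ae hb] with x h3 h4 h5 h6 h7 h8 h9 h10 hx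
    have h11 := h3 (hSW hx)
    have hx1 : x ∉ σ ⁻¹' S := fun h => hσS x hx (hSW h)
    have hx2 : σ x ∈ σ ⁻¹' S := by rwa [Set.mem_preimage, D.involutive]
    rw [Set.indicator_of_notMem hx1] at h9
    rw [Set.indicator_of_mem hx2] at h10
    rw [h4, h5, h6, h7, h8, D.involutive, h9, h10] at h11
    -- Orthogonality of the matrix columns trades the term with $\overline{h_2(\sigma
    -- x)}\,h_1(\sigma x)$ for $-\overline{h_1(x)}\,h_2(x)$.
    have h12 : conj (h₁ x) * h₂ x * (expo α x - expo α (σ x)) = 0 := by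
      linear_combination h11 - expo α (σ x) * (D.star_mul x).2
    rcases mul_eq_zero.1 h12 with h | h
    · rcases mul_eq_zero.1 h with h | h
      · exact hS₁ x hx (by simpa using h)
      · exact hS₂ x hx h
    · exact hα x hx (sub_eq_zero.1 h).symm

/-- Where $\sigma$ is the identity, $U^*$ cannot move mass of $\chi_S$ into `dilates W`. -/
theorem indicator_mem_coreSpace {S : Set ℝ} (hS : MeasurableSet S) (hSt : volume S ≠ ⊤)
    (hSW : ∀ x ∈ S, x ∉ dilates W) (hσS : ∀ x ∈ S, σ x = x) :
    fourierEquivL2.symm (indicatorConstLp 2 hS hSt 1) ∈ coreSpace ψ := by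
  rw [D.mem_coreSpace_iff hψ₁ hψ, ← fourierEquivL2_apply, LinearIsometryEquiv.apply_symm_apply]
  have hb : ∀ᵐ x : ℝ, (indicatorConstLp 2 hS hSt (1 : ℂ) : L2R) x = S.indicator (fun _ => 1) x :=
    indicatorConstLp_coeFn
  filter_upwards [D.inv_coeFn (indicatorConstLp 2 hS hSt 1), hb,
    D.measurePreserving.quasiMeasurePreserving.ae hb] with x h1 h2 h3 hx
  have hx1 : x ∉ S := fun h => hSW x h hx
  have hx2 : σ x ∉ S := fun h => by
    have := hσS _ h
    rw [D.involutive] at this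
    exact hx1 (this ▸ h)
  rw [h1, h2, h3, Set.indicator_of_notMem hx1, Set.indicator_of_notMem hx2, mul_zero, mul_zero,
    add_zero]

end InterpolationData

/-! ### Scaling functions -/

/-- The kernel of a bounded operator is a closed subspace, so linear relations between values of
transforms pass from the generators to the whole space. -/
theorem closure_span_translation_le {φ : L2R} (A : L2R →L[ℂ] L2R)
    (hA : ∀ l : ℤ, A (fourierHat (translation (l : ℝ) φ)) = 0) {f : L2R}
    (hf : f ∈ (Submodule.span ℂ
      (Set.range fun l : ℤ => translation (l : ℝ) φ)).topologicalClosure) :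
    A (fourierHat f) = 0 := by
  set B : L2R →L[ℂ] L2R := A.comp fourierEquivL2.toLinearIsometry.toContinuousLinearMap
  have h : f ∈ LinearMap.ker B.toLinearMap := by
    refine Submodule.topologicalClosure_minimal _ ?_ B.isClosed_ker hf
    rw [Submodule.span_le]
    rintro _ ⟨l, rfl⟩
    exact hA l
  exact h

/-- A core space containing two functions whose Fourier transforms are the indicators of `S` and of
`S + 2π`, with `S` and `S + 2π` disjoint, has no scaling function. -/
theorem not_isMRAWavelet_of_indicator_mem {ψ f g : L2R} {S : Set ℝ} (hS : MeasurableSet S)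
    (hS0 : volume S ≠ 0) (hdisj : ∀ x ∈ S, x + 2 * Real.pi ∉ S)
    (hf : f ∈ coreSpace ψ) (hg : g ∈ coreSpace ψ)
    (hf' : ∀ᵐ x, fourierHat f x = S.indicator (fun _ => 1) x)
    (hg' : ∀ᵐ x, fourierHat g x = S.indicator (fun _ => 1) (x - 2 * Real.pi)) :
    ¬ IsMRAWavelet ψ := by
  rintro ⟨-, φ, -, hφ⟩
  rw [← hφ] at hf hg
  have hσ := measurePreserving_add_right volume (2 * Real.pi)
  set p : ℝ → ℂ := fun x => fourierHat φ x with hp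
  have hpm : Measurable p := (Lp.stronglyMeasurable (fourierHat φ)).measurable
  -- The transform of $\varphi$ may be unbounded; dividing by this strictly positive weight turns
  -- the relation in `hrel` into the kernel of a bounded operator.
  set w : ℝ → ℝ := fun x => 1 + ‖p x‖ + ‖p (x + 2 * Real.pi)‖ with hw
  have hw0 : ∀ x, 0 < w x := fun x => by positivity
  have hw0' : ∀ x, (w x : ℂ) ≠ 0 := fun x => Complex.ofReal_ne_zero.2 (hw0 x).ne'
  have hpm' : Measurable fun x => p (x + 2 * Real.pi) := hpm.comp hσ.measurable
  have hwm : Measurable fun x => (w x : ℂ) :=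
    Complex.measurable_ofReal.comp ((measurable_const.add hpm.norm).add hpm'.norm)
  have hnw : ∀ x, ‖(w x : ℂ)‖ = w x := fun x => by
    rw [Complex.norm_real, Real.norm_of_nonneg (hw0 x).le]
  have hu : UnitBounded fun x => p (x + 2 * Real.pi) / w x :=
    ⟨hpm'.div hwm, fun x => by
      rw [norm_div, hnw, div_le_one (hw0 x)]
      linarith [norm_nonneg (p x), norm_nonneg (p (x + 2 * Real.pi)), congrFun hw x]⟩
  have hv : UnitBounded fun x => -p x / w x :=
    ⟨hpm.neg.div hwm, fun x => by
      rw [norm_div, hnw, div_le_one (hw0 x), norm_neg]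
      linarith [norm_nonneg (p x), norm_nonneg (p (x + 2 * Real.pi)), congrFun hw x]⟩
  have htr : ∀ l : ℤ, ∀ᵐ x, fourierHat (translation (l : ℝ) φ) x = expo l x * p x := fun l => by
    rw [fourierHat_translation]
    exact mulOp_coeFn _ _ _
  have hper : ∀ (l : ℤ) x, expo l (x + 2 * Real.pi) = expo l x := fun l x => by
    have := expo_two_pi l l rfl 1
    rw [Int.cast_one, mul_one] at this
    rw [expo_add_right, this, mul_one]
  -- The generators are $p$ times $2\pi$-periodic exponentials, so their values at $x$ and $x+2\pi$
  -- are proportional to $(p(x),p(x+2\pi))$.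
  have hrel : ∀ h ∈ (Submodule.span ℂ
      (Set.range fun l : ℤ => translation (l : ℝ) φ)).topologicalClosure,
      ∀ᵐ x, p (x + 2 * Real.pi) * fourierHat h x = p x * fourierHat h (x + 2 * Real.pi) := by
    intro h hh
    have h0 := closure_span_translation_le (interpOp _ _ hu hv _ hσ) (fun l => by
      rw [Lp.eq_zero_iff_ae_eq_zero]
      filter_upwards [interpOp_coeFn hu hv hσ (fourierHat (translation (l : ℝ) φ)), htr l,
        hσ.quasiMeasurePreserving.ae (htr l)] with x h1 h2 h3
      rw [h1, h2, h3, hper]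
      simp only [Pi.zero_apply]
      ring) hh
    rw [Lp.eq_zero_iff_ae_eq_zero] at h0
    filter_upwards [h0, interpOp_coeFn hu hv hσ (fourierHat h)] with x h1 h2
    rw [h2] at h1
    have h3 := hw0' x
    simp only [Pi.zero_apply] at h1
    field_simp at h1
    linear_combination h1
  -- For $x\in S$ the function `g` has transform $0$ at $x$ and $1$ at $x+2\pi$, which forces
  -- $p(x)=0$. Then every transform in the core space vanishes on $S$, contradicting `f`.
  have hp0 : ∀ᵐ x, x ∈ S → p x = 0 := by
    filter_upwards [hrel g hg, hg', hσ.quasiMeasurePreserving.ae hg'] with x h1 h2 h3 hx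
    have hx' : x - 2 * Real.pi ∉ S := fun h => hdisj _ h (by rwa [sub_add_cancel])
    rw [h2, h3, add_sub_cancel_right, Set.indicator_of_mem hx, Set.indicator_of_notMem hx',
      mul_zero, mul_one] at h1
    exact h1.symm
  have hI := unitBounded_indicator hS
  have h0 := closure_span_translation_le (mulOp _ hI) (fun l => by
      rw [Lp.eq_zero_iff_ae_eq_zero]
      filter_upwards [mulOp_coeFn _ hI (fourierHat (translation (l : ℝ) φ)), htr l, hp0]
        with x h1 h2 h3
      rw [h1, h2]
      by_cases hx : x ∈ S
      · simp [h3 hx]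
      · simp [hx]) hf
  rw [Lp.eq_zero_iff_ae_eq_zero] at h0
  refine hS0 ?_
  suffices h : ∀ᵐ x : ℝ, x ∉ S by simpa [ae_iff] using h
  filter_upwards [h0, mulOp_coeFn _ hI (fourierHat f), hf'] with x h1 h2 h3 hx
  rw [h2, h3, Set.indicator_of_mem hx] at h1
  simp at h1

/-! ### Pairs of wavelet sets that differ by swapping two dyadic orbits -/

/-- With countably many displacements $\sigma$ is piecewise a translation. Cutting a set by
displacement gives one inequality of measures, and involutivity gives the reverse. -/
theorem measurePreserving_of_involutive {σ : ℝ → ℝ} (hm : Measurable σ)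
    (hi : Function.Involutive σ) (hc : (Set.range fun x => σ x - x).Countable) :
    MeasurePreserving σ volume volume := by
  have key : ∀ A, MeasurableSet A → volume (σ ⁻¹' A) ≤ volume A := by
    intro A hA
    set V := Set.range fun x => σ x - x
    have : Countable V := hc.to_subtype
    have hd : Measurable fun x => σ x - x := hm.sub measurable_id
    -- The pieces are indexed on the image side: if $y=\sigma(x)$ then $\sigma(y)=x$, so
    -- $y-\sigma(y)$ is the displacement at $x$. This makes them disjoint.
    set F : V → Set ℝ := fun v => A ∩ {y | y - σ y = v} with hF
    have hFm : ∀ v, MeasurableSet (F v) := fun v =>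
      hA.inter ((measurable_id.sub hm) (measurableSet_singleton (v : ℝ)))
    have hFd : Pairwise (Function.onFun Disjoint F) := fun v w hvw =>
      Set.disjoint_left.2 fun x hx hx' => hvw (Subtype.ext (hx.2.symm.trans hx'.2))
    have hsub : σ ⁻¹' A ⊆ ⋃ v : V, (fun x => x + (v : ℝ)) ⁻¹' F v := fun x hx => by
      refine Set.mem_iUnion.2 ⟨⟨σ x - x, x, rfl⟩, ?_⟩
      have h1 : x + (σ x - x) = σ x := by ring
      simp only [hF, Set.mem_preimage, h1]
      exact ⟨hx, by simp [hi x]⟩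
    calc volume (σ ⁻¹' A) ≤ ∑' v : V, volume ((fun x => x + (v : ℝ)) ⁻¹' F v) :=
          (measure_mono hsub).trans (measure_iUnion_le _)
      _ = ∑' v : V, volume (F v) := by simp_rw [measure_preimage_add_right]
      _ = volume (⋃ v, F v) := (measure_iUnion hFd hFm).symm
      _ ≤ volume A := measure_mono (Set.iUnion_subset fun v => Set.inter_subset_left)
  refine ⟨hm, Measure.ext fun A hA => ?_⟩
  rw [Measure.map_apply hm hA]
  refine le_antisymm (key A hA) ?_
  have h := key (σ ⁻¹' A) (hm hA)
  rwa [← Set.preimage_comp, hi.comp_self, Set.preimage_id] at h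

theorem expo_eq_one {α x : ℝ} {k : ℤ} (h : α * x = 2 * k * Real.pi) : expo α x = 1 := by
  rw [expo, Complex.exp_eq_one_iff]
  refine ⟨-k, ?_⟩
  have h' : (α : ℂ) * x = 2 * k * Real.pi := by exact_mod_cast h
  rw [mul_assoc, h']
  push_cast
  ring

/-- The exponent `n` with `2⁻ⁿ x ∈ W`. -/
def tileIndex (W : Set ℝ) (x : ℝ) : ℤ :=
  open Classical in if h : ∃ n : ℤ, (2 : ℝ) ^ (-n) * x ∈ W then h.choose else 0

theorem IsDyadicTile.exists_zpow {W : Set ℝ} (hW : IsDyadicTile W) {x : ℝ} (hx : x ≠ 0) :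
    ∃ n : ℤ, (2 : ℝ) ^ (-n) * x ∈ W := by
  obtain ⟨n, hn, -⟩ := hW.existsUnique x hx
  exact ⟨-n, by rwa [neg_neg]⟩

theorem IsDyadicTile.tileIndex_eq {W : Set ℝ} (hW : IsDyadicTile W) {x : ℝ} {n : ℤ}
    (hn : (2 : ℝ) ^ (-n) * x ∈ W) : tileIndex W x = n := by
  have h : ∃ n : ℤ, (2 : ℝ) ^ (-n) * x ∈ W := ⟨n, hn⟩
  rw [tileIndex, dif_pos h]
  exact neg_injective (hW.eq_of_mem h.choose_spec hn)

theorem IsDyadicTile.tileIndex_mul {W : Set ℝ} (hW : IsDyadicTile W) {x : ℝ} (hx : x ∈ W)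
    (n : ℤ) : tileIndex W ((2 : ℝ) ^ n * x) = n :=
  hW.tileIndex_eq (by rwa [← mul_assoc, ← zpow_add₀ two_ne_zero, neg_add_cancel, zpow_zero,
    one_mul])

theorem IsDyadicTile.tileIndex_zero {W : Set ℝ} (hW : IsDyadicTile W) : tileIndex W 0 = 0 :=
  dif_neg (by simpa using hW.zero_notMem)

theorem IsDyadicTile.measurable_tileIndex {W : Set ℝ} (hW : IsDyadicTile W)
    (hm : MeasurableSet W) : Measurable (tileIndex W) := by
  refine measurable_to_countable' fun n => ?_
  -- The origin lies in no dilate of $W$ and takes the default index $0$, so it belongs to the fibre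
  -- over $n=0$ only.
  have h : tileIndex W ⁻¹' {n} = {x | (2 : ℝ) ^ (-n) * x ∈ W} ∪ ({0} ∩ {_x | n = 0}) := by
    ext x
    simp only [Set.mem_preimage, Set.mem_singleton_iff, Set.mem_union, Set.mem_inter_iff]
    constructor
    · rintro rfl
      by_cases hx : x = 0
      · subst hx
        exact Or.inr ⟨rfl, hW.tileIndex_zero⟩
      · obtain ⟨n, hn⟩ := hW.exists_zpow hx
        left
        change (2 : ℝ) ^ (-tileIndex W x) * x ∈ W
        rwa [hW.tileIndex_eq hn]
    · rintro (h | ⟨rfl, h⟩)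
      · exact hW.tileIndex_eq h
      · exact hW.tileIndex_zero.trans h.symm
  rw [h]
  exact ((measurable_const_mul _) hm).union ((measurableSet_singleton 0).inter (.const _))

/-- The wavelet sets `W₁ = P ∪ I ∪ 2ʲ(I - c)` and `W₂ = P ∪ (I - c) ∪ 2ʲ I`, where
`c = 2ᴺ · 2π`. -/
structure SwapData (W₁ W₂ P I : Set ℝ) (c : ℝ) (j N : ℕ) : Prop where
  measurableSet_P : MeasurableSet P
  measurableSet_I : MeasurableSet I
  volume_ne_zero : volume I ≠ 0
  volume_ne_top : volume I ≠ ⊤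
  dyadicTile : IsDyadicTile W₁
  translationTile : IsTranslationTile W₁
  mem₁ : ∀ x, x ∈ W₁ ↔ x ∈ P ∨ x ∈ I ∨ x / 2 ^ j + c ∈ I
  mem₂ : ∀ x, x ∈ W₂ ↔ x ∈ P ∨ x + c ∈ I ∨ x / 2 ^ j ∈ I
  disjoint_P : ∀ x ∈ P, x ∉ I ∧ x / 2 ^ j + c ∉ I
  disjoint_I : ∀ x ∈ I, x / 2 ^ j + c ∉ I
  shift_eq : c = 2 * 2 ^ N * Real.pi
  exponent_pos : 0 < j

/-- The displacement of the interpolation map on `W₁`. -/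
def swapShift (I : Set ℝ) (c : ℝ) (j : ℕ) (x : ℝ) : ℝ :=
  open Classical in if x ∈ I then -c else if x / 2 ^ j + c ∈ I then 2 ^ j * c else 0

/-- The interpolation map. -/
def swapMap (W I : Set ℝ) (c : ℝ) (j : ℕ) (x : ℝ) : ℝ :=
  x + 2 ^ tileIndex W x * swapShift I c j (2 ^ (-tileIndex W x) * x)

/-- The first interpolation coefficient. -/
def swapCoeff₁ (W I : Set ℝ) (c : ℝ) (j : ℕ) (x : ℝ) : ℂ :=
  open Classical in if 2 ^ (-tileIndex W x) * x ∈ I then invSqrtTwo else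
    if 2 ^ (-tileIndex W x) * x / 2 ^ j + c ∈ I then invSqrtTwo else 1

/-- The second interpolation coefficient. -/
def swapCoeff₂ (W I : Set ℝ) (c : ℝ) (j : ℕ) (x : ℝ) : ℂ :=
  open Classical in if 2 ^ (-tileIndex W x) * x ∈ I then -invSqrtTwo else
    if 2 ^ (-tileIndex W x) * x / 2 ^ j + c ∈ I then invSqrtTwo else 0

theorem invSqrtTwo_mul_self : invSqrtTwo * invSqrtTwo = 1 / 2 := by
  rw [invSqrtTwo, ← Complex.ofReal_mul, ← mul_div_mul_comm, Real.mul_self_sqrt two_pos.le]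
  push_cast
  norm_num

theorem conj_invSqrtTwo : conj invSqrtTwo = invSqrtTwo := Complex.conj_ofReal _

theorem invSqrtTwo_ne_zero : invSqrtTwo ≠ 0 := fun h => by
  have := invSqrtTwo_mul_self
  rw [h] at this
  norm_num at this

theorem norm_invSqrtTwo_le : ‖invSqrtTwo‖ ≤ 1 := by
  rw [invSqrtTwo, Complex.norm_real, Real.norm_of_nonneg (by positivity),
    div_le_one (by positivity)]
  exact Real.one_le_sqrt.2 one_le_two

theorem eq_two_pow_mul_sub (c : ℝ) (j : ℕ) (x : ℝ) : x = 2 ^ (j : ℤ) * (x / 2 ^ j + c - c) := by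
  rw [add_sub_cancel_right, zpow_natCast, mul_div_cancel₀ _ (by positivity)]

theorem exists_swapShift_eq (I : Set ℝ) (c : ℝ) (j : ℕ) (x : ℝ) : ∃ k : ℤ, swapShift I c j x = k * c := by
  unfold swapShift
  split_ifs
  · exact ⟨-1, by simp⟩
  · exact ⟨2 ^ j, by simp⟩
  · exact ⟨0, by simp⟩

/-! ### The swap along dyadic orbits and transport of the tiling properties -/

namespace SwapData

variable {W₁ W₂ P I : Set ℝ} {c : ℝ} {j N : ℕ} (S : SwapData W₁ W₂ P I c j N)

include S

theorem measurableSet_orbit : MeasurableSet {x : ℝ | x / 2 ^ j + c ∈ I} :=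
  ((measurable_id.div_const _).add_const _) S.measurableSet_I

theorem measurableSet₁ : MeasurableSet W₁ := by
  have h : W₁ = P ∪ (I ∪ {x : ℝ | x / 2 ^ j + c ∈ I}) := by
    ext x; exact S.mem₁ x
  rw [h]
  exact S.measurableSet_P.union (S.measurableSet_I.union S.measurableSet_orbit)

theorem measurableSet₂ : MeasurableSet W₂ := by
  have h : W₂ = P ∪ ({x : ℝ | x + c ∈ I} ∪ {x : ℝ | x / 2 ^ j ∈ I}) := by
    ext x; exact S.mem₂ x
  rw [h]
  exact S.measurableSet_P.union (((measurable_id.add_const _) S.measurableSet_I).union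
    ((measurable_id.div_const _) S.measurableSet_I))

theorem measurable_normalized : Measurable fun x => (2 : ℝ) ^ (-tileIndex W₁ x) * x :=
  ((measurable_from_top (f := fun n : ℤ => (2 : ℝ) ^ (-n))).comp
    (S.dyadicTile.measurable_tileIndex S.measurableSet₁)).mul measurable_id

theorem measurable_swapMap : Measurable (swapMap W₁ I c j) := by
  have h : Measurable (swapShift I c j) :=
    Measurable.ite S.measurableSet_I measurable_const
      (Measurable.ite S.measurableSet_orbit measurable_const measurable_const)
  exact measurable_id.add (((measurable_from_top (f := fun n : ℤ => (2 : ℝ) ^ n)).comp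
    (S.dyadicTile.measurable_tileIndex S.measurableSet₁)).mul (h.comp S.measurable_normalized))

theorem unitBounded_swapCoeff₁ : UnitBounded (swapCoeff₁ W₁ I c j) := by
  constructor
  · exact Measurable.ite (S.measurable_normalized S.measurableSet_I) measurable_const
      (Measurable.ite (S.measurable_normalized S.measurableSet_orbit) measurable_const
        measurable_const)
  · intro x
    unfold swapCoeff₁
    split_ifs
    · exact norm_invSqrtTwo_le
    · exact norm_invSqrtTwo_le
    · simp

theorem unitBounded_swapCoeff₂ : UnitBounded (swapCoeff₂ W₁ I c j) := by
  constructor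
  · exact Measurable.ite (S.measurable_normalized S.measurableSet_I) measurable_const
      (Measurable.ite (S.measurable_normalized S.measurableSet_orbit) measurable_const
        measurable_const)
  · intro x
    unfold swapCoeff₂
    split_ifs
    · rw [norm_neg]; exact norm_invSqrtTwo_le
    · exact norm_invSqrtTwo_le
    · simp

theorem swap_of_mem_P {x : ℝ} (hx : x ∈ P) (n : ℤ) :
    swapMap W₁ I c j (2 ^ n * x) = 2 ^ n * x ∧ swapCoeff₁ W₁ I c j (2 ^ n * x) = 1 ∧
      swapCoeff₂ W₁ I c j (2 ^ n * x) = 0 := by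
  have h := S.dyadicTile.tileIndex_mul ((S.mem₁ x).2 (Or.inl hx)) n
  have h' : (2 : ℝ) ^ (-n) * (2 ^ n * x) = x := by
    rw [← mul_assoc, ← zpow_add₀ two_ne_zero, neg_add_cancel, zpow_zero, one_mul]
  obtain ⟨h1, h2⟩ := S.disjoint_P x hx
  simp [swapMap, swapCoeff₁, swapCoeff₂, swapShift, h, h', h1, h2, -zpow_neg]

theorem swap_of_mem_I {x : ℝ} (hx : x ∈ I) (n : ℤ) :
    swapMap W₁ I c j (2 ^ n * x) = 2 ^ n * (x - c) ∧
      swapCoeff₁ W₁ I c j (2 ^ n * x) = invSqrtTwo ∧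
      swapCoeff₂ W₁ I c j (2 ^ n * x) = -invSqrtTwo := by
  have h := S.dyadicTile.tileIndex_mul ((S.mem₁ x).2 (Or.inr (Or.inl hx))) n
  have h' : (2 : ℝ) ^ (-n) * (2 ^ n * x) = x := by
    rw [← mul_assoc, ← zpow_add₀ two_ne_zero, neg_add_cancel, zpow_zero, one_mul]
  simp [swapMap, swapCoeff₁, swapCoeff₂, swapShift, h, h', hx, -zpow_neg]
  ring

theorem two_pow_mul_sub_mem {x : ℝ} (hx : x ∈ I) : (2 : ℝ) ^ (j : ℤ) * (x - c) ∈ W₁ := by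
  refine (S.mem₁ _).2 (Or.inr (Or.inr ?_))
  rw [zpow_natCast, mul_div_cancel_left₀ _ (by positivity), sub_add_cancel]
  exact hx

/-- The representative of this orbit in $W_1$ is $2^j(x-c)$, so the tile index is $n-j$; the
displacement $2^jc$ there rescales to $2^nc$. -/
theorem swap_of_mem_sub {x : ℝ} (hx : x ∈ I) (n : ℤ) :
    swapMap W₁ I c j (2 ^ n * (x - c)) = 2 ^ n * x ∧
      swapCoeff₁ W₁ I c j (2 ^ n * (x - c)) = invSqrtTwo ∧
      swapCoeff₂ W₁ I c j (2 ^ n * (x - c)) = invSqrtTwo := by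
  have h := S.dyadicTile.tileIndex_mul (S.two_pow_mul_sub_mem hx) (n - j)
  rw [← mul_assoc, ← zpow_add₀ two_ne_zero, sub_add_cancel] at h
  have h' : (2 : ℝ) ^ (-(n - (j : ℤ))) * (2 ^ n * (x - c)) = 2 ^ j * (x - c) := by
    rw [← mul_assoc, ← zpow_add₀ two_ne_zero, neg_sub, sub_add_cancel, zpow_natCast]
  have h1 : (2 : ℝ) ^ j * (x - c) / 2 ^ j + c = x := by
    rw [mul_div_cancel_left₀ _ (by positivity), sub_add_cancel]
  have h2 : (2 : ℝ) ^ j * (x - c) ∉ I := fun h => S.disjoint_I _ h (by rwa [h1])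
  have h3 : (2 : ℝ) ^ (n - (j : ℤ)) * (2 ^ j * c) = 2 ^ n * c := by
    rw [← mul_assoc, ← zpow_natCast, ← zpow_add₀ two_ne_zero, sub_add_cancel]
  simp only [swapMap, swapCoeff₁, swapCoeff₂, swapShift, h, h', h1, h2, hx, if_true, if_false, h3,
    and_self, and_true]
  ring

/-- Case distinction along the dyadic orbits. -/
theorem cases_orbit (x : ℝ) : x = 0 ∨ (∃ n : ℤ, ∃ y ∈ P, x = 2 ^ n * y) ∨
    (∃ n : ℤ, ∃ y ∈ I, x = 2 ^ n * y) ∨ ∃ n : ℤ, ∃ y ∈ I, x = 2 ^ n * (y - c) := by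
  by_cases hx : x = 0
  · exact Or.inl hx
  obtain ⟨n, hn⟩ := S.dyadicTile.exists_zpow hx
  have hx' : x = 2 ^ n * (2 ^ (-n) * x) := by
    rw [← mul_assoc, ← zpow_add₀ two_ne_zero, add_neg_cancel, zpow_zero, one_mul]
  rcases (S.mem₁ _).1 hn with h | h | h
  · exact Or.inr (Or.inl ⟨n, _, h, hx'⟩)
  · exact Or.inr (Or.inr (Or.inl ⟨n, _, h, hx'⟩))
  · refine Or.inr (Or.inr (Or.inr ⟨n + j, _, h, ?_⟩))
    rw [zpow_add₀ two_ne_zero, mul_assoc, ← eq_two_pow_mul_sub c j]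
    exact hx'

theorem swap_zero : swapMap W₁ I c j 0 = 0 ∧ swapCoeff₁ W₁ I c j 0 = 1 ∧
    swapCoeff₂ W₁ I c j 0 = 0 := by
  have h0 := S.dyadicTile.zero_notMem
  have h1 : (0 : ℝ) ∉ I := fun h => h0 ((S.mem₁ 0).2 (Or.inr (Or.inl h)))
  have h2 : c ∉ I := fun h => h0 ((S.mem₁ 0).2 (Or.inr (Or.inr (by simpa using h))))
  simp [swapMap, swapCoeff₁, swapCoeff₂, swapShift, h1, h2]

theorem homogeneous (x : ℝ) : swapMap W₁ I c j (2 * x) = 2 * swapMap W₁ I c j x ∧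
    swapCoeff₁ W₁ I c j (2 * x) = swapCoeff₁ W₁ I c j x ∧
    swapCoeff₂ W₁ I c j (2 * x) = swapCoeff₂ W₁ I c j x := by
  have h2 : ∀ (n : ℤ) (y : ℝ), 2 * ((2 : ℝ) ^ n * y) = 2 ^ (n + 1) * y := fun n y => by
    rw [zpow_add_one₀ two_ne_zero]; ring
  rcases S.cases_orbit x with rfl | ⟨n, y, hy, rfl⟩ | ⟨n, y, hy, rfl⟩ | ⟨n, y, hy, rfl⟩
  · simp [S.swap_zero]
  · simp only [h2, S.swap_of_mem_P hy, and_self]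
  · simp only [h2, S.swap_of_mem_I hy, and_self]
  · simp only [h2, S.swap_of_mem_sub hy, and_self]

theorem involutive : Function.Involutive (swapMap W₁ I c j) := by
  intro x
  rcases S.cases_orbit x with rfl | ⟨n, y, hy, rfl⟩ | ⟨n, y, hy, rfl⟩ | ⟨n, y, hy, rfl⟩
  · simp [S.swap_zero]
  · simp only [S.swap_of_mem_P hy]
  · simp only [S.swap_of_mem_I hy, S.swap_of_mem_sub hy]
  · simp only [S.swap_of_mem_I hy, S.swap_of_mem_sub hy]

theorem measurePreserving : MeasurePreserving (swapMap W₁ I c j) volume volume := by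
  refine measurePreserving_of_involutive S.measurable_swapMap S.involutive ?_
  refine Set.Countable.mono (s₂ := Set.range fun p : ℤ × ℤ => (p.1 : ℝ) * (2 ^ p.2 * c)) ?_
    (Set.countable_range _)
  rintro _ ⟨x, rfl⟩
  rcases S.cases_orbit x with rfl | ⟨n, y, hy, rfl⟩ | ⟨n, y, hy, rfl⟩ | ⟨n, y, hy, rfl⟩
  · exact ⟨(0, 0), by simp [S.swap_zero]⟩
  · exact ⟨(0, 0), by simp [S.swap_of_mem_P hy]⟩
  · refine ⟨(-1, n), ?_⟩
    simp only [S.swap_of_mem_I hy]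
    push_cast
    ring
  · refine ⟨(1, n), ?_⟩
    simp only [S.swap_of_mem_sub hy]
    push_cast
    ring

/-- The matrix is the identity on the orbits of $P$ and a rotation by $\pm45^\circ$ on the exchanged
orbits; the opposite signs of the second coefficient on the two orbits make its rows orthogonal. -/
theorem unitary (x : ℝ) : !![swapCoeff₁ W₁ I c j x, swapCoeff₂ W₁ I c j x;
    swapCoeff₂ W₁ I c j (swapMap W₁ I c j x), swapCoeff₁ W₁ I c j (swapMap W₁ I c j x)] ∈
      Matrix.unitaryGroup (Fin 2) ℂ := by
  have hs := invSqrtTwo_mul_self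
  rw [Matrix.mem_unitaryGroup_iff]
  rcases S.cases_orbit x with rfl | ⟨n, y, hy, rfl⟩ | ⟨n, y, hy, rfl⟩ | ⟨n, y, hy, rfl⟩
  · ext i k
    fin_cases i <;> fin_cases k <;> simp [Matrix.mul_apply, Matrix.star_apply, S.swap_zero]
  · ext i k
    fin_cases i <;> fin_cases k <;>
      simp [Matrix.mul_apply, Matrix.star_apply, S.swap_of_mem_P hy]
  · ext i k
    fin_cases i <;> fin_cases k <;>
      simp [Matrix.mul_apply, Matrix.star_apply, S.swap_of_mem_I hy, S.swap_of_mem_sub hy,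
        conj_invSqrtTwo, hs] <;> norm_num
  · ext i k
    fin_cases i <;> fin_cases k <;>
      simp [Matrix.mul_apply, Matrix.star_apply, S.swap_of_mem_I hy, S.swap_of_mem_sub hy,
        conj_invSqrtTwo, hs] <;> norm_num

theorem swapMap_of_mem {x : ℝ} (hx : x ∈ W₁) :
    swapMap W₁ I c j x = x + swapShift I c j x := by
  have h : tileIndex W₁ x = 0 := S.dyadicTile.tileIndex_eq (by simpa using hx)
  simp [swapMap, h]

theorem congruence {x : ℝ} (hx : x ∈ W₁) :
    ∃ k : ℤ, swapMap W₁ I c j x = x + 2 * k * Real.pi := by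
  obtain ⟨k, hk⟩ := exists_swapShift_eq I c j x
  refine ⟨k * 2 ^ N, ?_⟩
  rw [S.swapMap_of_mem hx, hk, S.shift_eq]
  push_cast
  ring

theorem interpolationData :
    InterpolationData W₁ (swapMap W₁ I c j) (swapCoeff₁ W₁ I c j) (swapCoeff₂ W₁ I c j) where
  measurableSet := S.measurableSet₁
  dyadicTile := S.dyadicTile
  translationTile := S.translationTile
  involutive := S.involutive
  measurePreserving := S.measurePreserving
  homogeneous x := (S.homogeneous x).1
  congruence _ hx := S.congruence hx
  unit₁ := S.unitBounded_swapCoeff₁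
  unit₂ := S.unitBounded_swapCoeff₂
  periodic₁ x := (S.homogeneous x).2.1
  periodic₂ x := (S.homogeneous x).2.2
  unitary := S.unitary

theorem swapMap_mem₂ {x : ℝ} (hx : x ∈ W₁) : swapMap W₁ I c j x ∈ W₂ := by
  rcases (S.mem₁ x).1 hx with h | h | h
  · have := (S.swap_of_mem_P h 0).1
    rw [zpow_zero, one_mul] at this
    rw [this]
    exact (S.mem₂ x).2 (Or.inl h)
  · have := (S.swap_of_mem_I h 0).1
    rw [zpow_zero, one_mul, one_mul] at this
    rw [this]
    exact (S.mem₂ _).2 (Or.inr (Or.inl (by rwa [sub_add_cancel])))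
  · have := (S.swap_of_mem_sub h j).1
    rw [← eq_two_pow_mul_sub c j] at this
    rw [this]
    refine (S.mem₂ _).2 (Or.inr (Or.inr ?_))
    rwa [zpow_natCast, mul_div_cancel_left₀ _ (by positivity)]

theorem swapMap_mem₁ {x : ℝ} (hx : x ∈ W₂) : swapMap W₁ I c j x ∈ W₁ := by
  rcases (S.mem₂ x).1 hx with h | h | h
  · have := (S.swap_of_mem_P h 0).1
    rw [zpow_zero, one_mul] at this
    rw [this]
    exact (S.mem₁ x).2 (Or.inl h)
  · have := (S.swap_of_mem_sub h 0).1
    rw [zpow_zero, one_mul, one_mul, add_sub_cancel_right] at this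
    rw [this]
    exact (S.mem₁ _).2 (Or.inr (Or.inl h))
  · have := (S.swap_of_mem_I h j).1
    rw [zpow_natCast, mul_div_cancel₀ _ (by positivity), ← zpow_natCast] at this
    rw [this]
    exact S.two_pow_mul_sub_mem h

theorem swapMap_mem₁_iff {x : ℝ} : swapMap W₁ I c j x ∈ W₁ ↔ x ∈ W₂ :=
  ⟨fun h => by simpa [S.involutive x] using S.swapMap_mem₂ h, S.swapMap_mem₁⟩

theorem bijOn : Set.BijOn (swapMap W₁ I c j) W₁ W₂ :=
  ⟨fun _ hx => S.swapMap_mem₂ hx, S.involutive.injective.injOn,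
    fun x hx => ⟨_, S.swapMap_mem₁ hx, S.involutive x⟩⟩

/-- Since $\sigma$ commutes with dilations and $W_2=\sigma^{-1}(W_1)$, the exponents placing $x$ in
$W_2$ are those placing $\sigma(x)$ in $W_1$. -/
theorem dyadicTile₂ : IsDyadicTile W₂ where
  zero_notMem h := S.dyadicTile.zero_notMem (by
    have := S.swapMap_mem₁ h
    rwa [S.swap_zero.1] at this)
  existsUnique x hx := by
    have hx' : swapMap W₁ I c j x ≠ 0 := fun h => hx (by
      rw [← S.involutive x, h, S.swap_zero.1])
    have h : ∀ n : ℤ, (2 : ℝ) ^ n * x ∈ W₂ ↔ (2 : ℝ) ^ n * swapMap W₁ I c j x ∈ W₁ := fun n => by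
      rw [← S.swapMap_mem₁_iff, map_two_zpow_mul fun x => (S.homogeneous x).1]
    simp_rw [h]
    exact S.dyadicTile.existsUnique _ hx'

/-- On $W_1$ the bijection onto $W_2$ stays within classes modulo $2\pi$, so each class meets $W_2$
as often as it meets $W_1$. -/
theorem translationTile₂ : IsTranslationTile W₂ := by
  intro x
  have hback : ∀ n : ℤ, x + 2 * n * Real.pi ∈ W₂ → ∃ k : ℤ,
      swapMap W₁ I c j (x + 2 * n * Real.pi) = x + 2 * k * Real.pi := fun n hn => by
    obtain ⟨k, hk⟩ := S.congruence (S.swapMap_mem₁ hn)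
    rw [S.involutive] at hk
    refine ⟨n - k, ?_⟩
    push_cast
    linarith
  obtain ⟨n, hn, huniq⟩ := S.translationTile x
  obtain ⟨k, hk⟩ := S.congruence hn
  refine ⟨n + k, ?_, fun m hm => ?_⟩
  · have h := S.swapMap_mem₂ hn
    rw [hk] at h
    convert h using 1
    push_cast
    ring
  · obtain ⟨a, ha⟩ := hback m hm
    have h1 := S.swapMap_mem₁ hm
    rw [ha] at h1
    rw [huniq a h1] at ha
    have h2 := congrArg (swapMap W₁ I c j) ha
    rw [S.involutive, hk] at h2
    have h3 : ((m : ℝ) - n - k) * Real.pi = 0 := by linarith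
    have h4 := (mul_eq_zero.1 h3).resolve_right Real.pi_ne_zero
    have h5 : ((m - n - k : ℤ) : ℝ) = 0 := by push_cast; exact h4
    have h6 := Int.cast_eq_zero.1 h5
    omega

end SwapData

/-! ### Excluding scaling functions through the fixed part of the swap -/

theorem notMem_dilates {W : Set ℝ} (hW : IsDyadicTile W) {x : ℝ} {k : ℤ} (hk : 0 < k)
    (hx : (2 : ℝ) ^ k * x ∈ W) : x ∉ dilates W := by
  rintro ⟨n, hn⟩
  have := hW.eq_of_mem hx hn
  omega

theorem IsDyadicTile.mem_of_mem_dilates {W : Set ℝ} {x : ℝ} (hx : x ∈ dilates W) :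
    ∃ n : ℕ, ∃ y ∈ W, x = 2 ^ (n : ℤ) * y := by
  obtain ⟨n, hn⟩ := hx
  refine ⟨n, _, hn, ?_⟩
  rw [← mul_assoc, ← zpow_add₀ two_ne_zero, add_neg_cancel, zpow_zero, one_mul]

/-- If some `S` and `S + 2π` are contained in `⋃_{k > 0} 2⁻ᵏ Q` for a part `Q ⊆ W` fixed by the
interpolation map, the interpolated wavelet is not an MRA wavelet. -/
theorem InterpolationData.not_isMRAWavelet {W Q S : Set ℝ} {σ : ℝ → ℝ} {h₁ h₂ : ℝ → ℂ}
    (D : InterpolationData W σ h₁ h₂) {ψ₁ ψ : L2R}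
    (hψ₁ : fourierHat ψ₁ =ᵐ[volume] W.indicator fun _ => msfConst)
    (hψ : fourierHat ψ = D.op (fourierHat ψ₁)) (hQ : Q ⊆ W) (hσ : ∀ x ∈ Q, σ x = x)
    (hS : MeasurableSet S) (hS0 : volume S ≠ 0) (hSt : volume S ≠ ⊤)
    (hdisj : ∀ x ∈ S, x + 2 * Real.pi ∉ S) (hSQ : ∀ x ∈ S, ∃ k : ℤ, 0 < k ∧ (2 : ℝ) ^ k * x ∈ Q)
    (hSQ' : ∀ x ∈ S, ∃ k : ℤ, 0 < k ∧ (2 : ℝ) ^ k * (x + 2 * Real.pi) ∈ Q) :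
    ¬ IsMRAWavelet ψ := by
  -- By homogeneity a point is fixed as soon as one of its dyadic dilates is.
  have hfix : ∀ {x : ℝ} {k : ℤ}, (2 : ℝ) ^ k * x ∈ Q → σ x = x := fun {x k} hx => by
    have h := hσ _ hx
    rw [map_two_zpow_mul D.homogeneous] at h
    exact mul_left_cancel₀ (zpow_pos two_pos k).ne' h
  have hsub := measurePreserving_sub_right volume (2 * Real.pi)
  set T : Set ℝ := (fun x => x - 2 * Real.pi) ⁻¹' S
  have hT : MeasurableSet T := hsub.measurable hS
  have hTt : volume T ≠ ⊤ := by rwa [hsub.measure_preimage hS.nullMeasurableSet]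
  have hTQ : ∀ x ∈ T, ∃ k : ℤ, 0 < k ∧ (2 : ℝ) ^ k * x ∈ Q := fun x hx => by
    have := hSQ' _ hx
    rwa [sub_add_cancel] at this
  have key : ∀ {R : Set ℝ} (hR : MeasurableSet R) (hRt : volume R ≠ ⊤),
      (∀ x ∈ R, ∃ k : ℤ, 0 < k ∧ (2 : ℝ) ^ k * x ∈ Q) →
      fourierEquivL2.symm (indicatorConstLp 2 hR hRt 1) ∈ coreSpace ψ := fun hR hRt hRQ => by
    refine D.indicator_mem_coreSpace hψ₁ hψ hR hRt (fun x hx => ?_) fun x hx => ?_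
    · obtain ⟨k, hk, hx⟩ := hRQ x hx
      exact notMem_dilates D.dyadicTile hk (hQ hx)
    · obtain ⟨k, hk, hx⟩ := hRQ x hx
      exact hfix hx
  refine not_isMRAWavelet_of_indicator_mem hS hS0 hdisj (key hS hSt hSQ) (key hT hTt hTQ) ?_ ?_
  · rw [← fourierEquivL2_apply, LinearIsometryEquiv.apply_symm_apply]
    exact indicatorConstLp_coeFn
  · rw [← fourierEquivL2_apply, LinearIsometryEquiv.apply_symm_apply]
    exact indicatorConstLp_coeFn

theorem InterpolationData.op_msf {W : Set ℝ} (hm : MeasurableSet W) (hd : IsDyadicTile W)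
    (ht : IsTranslationTile W) (f : L2R) : (InterpolationData.msf hm hd ht).op f = f := by
  apply Lp.ext
  filter_upwards [(InterpolationData.msf hm hd ht).op_coeFn f] with x h
  rw [h, one_mul, zero_mul, add_zero]

/-- An MSF wavelet is the trivial interpolation with identity map and coefficients $1$, $0$, so the
general criterion applies. -/
theorem not_isMRAWavelet_msf {W Q S : Set ℝ} {ψ : L2R} (hm : MeasurableSet W)
    (hd : IsDyadicTile W) (ht : IsTranslationTile W) (hψ : IsMSFWavelet W ψ) (hQ : Q ⊆ W)
    (hS : MeasurableSet S) (hS0 : volume S ≠ 0) (hSt : volume S ≠ ⊤)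
    (hdisj : ∀ x ∈ S, x + 2 * Real.pi ∉ S) (hSQ : ∀ x ∈ S, ∃ k : ℤ, 0 < k ∧ (2 : ℝ) ^ k * x ∈ Q)
    (hSQ' : ∀ x ∈ S, ∃ k : ℤ, 0 < k ∧ (2 : ℝ) ^ k * (x + 2 * Real.pi) ∈ Q) :
    ¬ IsMRAWavelet ψ :=
  (InterpolationData.msf hm hd ht).not_isMRAWavelet hψ.fourier_eq
    (InterpolationData.op_msf hm hd ht (fourierHat ψ)).symm hQ (fun _ _ => rfl) hS hS0 hSt hdisj
    hSQ hSQ'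

/-! ### Invariance class and explicit coefficients of the interpolated wavelet -/

namespace SwapData

variable {W₁ W₂ P I : Set ℝ} {c : ℝ} {j N : ℕ} (S : SwapData W₁ W₂ P I c j N)

/-- The interpolation map as a measurable equivalence. -/
def equiv : ℝ ≃ᵐ ℝ where
  toFun := swapMap W₁ I c j
  invFun := swapMap W₁ I c j
  left_inv := S.involutive
  right_inv := S.involutive
  measurable_toFun := S.measurable_swapMap
  measurable_invFun := S.measurable_swapMap

include S

/-- On $2^nW_1$ with $n\ge0$ the displacement is an integer multiple of $c=2^N\cdot2\pi$, hence
invisible to the character of frequency $m/2^N$. Negative $n$ would break this. -/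
theorem expo_swapMap (m : ℤ) {x : ℝ} (hx : x ∈ dilates W₁) :
    expo ((m : ℝ) / 2 ^ N) (swapMap W₁ I c j x) = expo ((m : ℝ) / 2 ^ N) x := by
  obtain ⟨n, y, hy, rfl⟩ := IsDyadicTile.mem_of_mem_dilates hx
  rw [map_two_zpow_mul fun x => (S.homogeneous x).1, S.swapMap_of_mem hy]
  obtain ⟨k, hk⟩ := exists_swapShift_eq I c j y
  rw [mul_add, expo_add_right, expo_eq_one (x := 2 ^ (n : ℤ) * swapShift I c j y)
    (k := m * 2 ^ n * k), mul_one]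
  rw [hk, S.shift_eq, zpow_natCast]
  push_cast
  field_simp

variable {ψ₁ ψ : L2R} (hψ₁ : fourierHat ψ₁ =ᵐ[volume] W₁.indicator fun _ => msfConst)
  (hψ : fourierHat ψ = S.interpolationData.op (fourierHat ψ₁))

include hψ₁ hψ

/-- Non-invariance at level $N+1$ is tested on $I$, where both coefficients are nonzero. The shifted
set $I-c$ avoids `dilates W₁` because it reaches $W_1$ only after multiplication by $2^j$ with
$j>0$. -/
theorem mem_classM : ψ ∈ classM N := by
  have D := S.interpolationData
  refine ⟨⟨D.isWavelet hψ₁ hψ, fun m f hf =>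
    D.translation_mem_coreSpace hψ₁ hψ (fun x hx => S.expo_swapMap m hx) hf⟩, fun h => ?_⟩
  have hI : ∀ x ∈ I, swapMap W₁ I c j x = x - c ∧ swapCoeff₁ W₁ I c j x = invSqrtTwo ∧
      swapCoeff₂ W₁ I c j x = -invSqrtTwo := fun x hx => by
    simpa using S.swap_of_mem_I hx 0
  obtain ⟨f, hf, hf'⟩ := D.exists_translation_notMem_coreSpace hψ₁ hψ
    (α := ((1 : ℤ) : ℝ) / 2 ^ (N + 1)) S.measurableSet_I S.volume_ne_zero S.volume_ne_top
    (fun x hx => subset_dilates W₁ ((S.mem₁ x).2 (Or.inr (Or.inl hx))))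
    (fun x hx => by
      rw [(hI x hx).1]
      exact notMem_dilates S.dyadicTile (Int.natCast_pos.2 S.exponent_pos)
        (S.two_pow_mul_sub_mem hx))
    (fun x hx => by rw [(hI x hx).2.1]; exact invSqrtTwo_ne_zero)
    (fun x hx => by rw [(hI x hx).2.2]; exact neg_ne_zero.2 invSqrtTwo_ne_zero)
    (fun x hx hcon => by
      -- Half the frequency allowed at level $N$ turns the shift by $c$ into a phase of exactly
      -- $\pi$.
      have h1 : expo (((1 : ℤ) : ℝ) / 2 ^ (N + 1)) (-c) = -1 := by
        rw [expo, S.shift_eq, ← Complex.exp_pi_mul_I]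
        congr 1
        push_cast
        field_simp
        ring
      rw [(hI x hx).1, sub_eq_add_neg, expo_add_right, h1] at hcon
      have h2 : expo (((1 : ℤ) : ℝ) / 2 ^ (N + 1)) x = 0 := by linear_combination -hcon / 2
      have h3 := norm_expo (((1 : ℤ) : ℝ) / 2 ^ (N + 1)) x
      rw [h2, norm_zero] at h3
      exact zero_ne_one h3)
  exact hf' (h.2 1 f hf)

/-- The operator uses $\hat\psi_1\circ\sigma$ where the interpolation formula has $\hat\psi_2$; they
agree since $\sigma^{-1}(W_1)=W_2$. -/
theorem isInterpolatedWavelet {ψ₂ : L2R} (h₁ : IsMSFWavelet W₁ ψ₁) (h₂ : IsMSFWavelet W₂ ψ₂) :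
    IsInterpolatedWavelet W₁ W₂ S.equiv (swapCoeff₁ W₁ I c j) (swapCoeff₂ W₁ I c j) ψ₁ ψ₂ ψ where
  msf₁ := h₁
  msf₂ := h₂
  interpolationMap := ⟨S.bijOn, fun _ hx => S.congruence hx, fun x => (S.homogeneous x).1⟩
  involutive := S.involutive
  coeff₁ := ⟨S.unitBounded_swapCoeff₁.measurable,
    ⟨1, Filter.Eventually.of_forall S.unitBounded_swapCoeff₁.norm_le⟩,
    fun x => (S.homogeneous x).2.1⟩
  coeff₂ := ⟨S.unitBounded_swapCoeff₂.measurable,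
    ⟨1, Filter.Eventually.of_forall S.unitBounded_swapCoeff₂.norm_le⟩,
    fun x => (S.homogeneous x).2.2⟩
  unitary := Filter.Eventually.of_forall S.unitary
  fourier_eq := by
    have h2 : ∀ᵐ x, fourierHat ψ₂ x = W₂.indicator (fun _ => msfConst) x := h₂.fourier_eq
    rw [hψ]
    filter_upwards [S.interpolationData.op_coeFn (fourierHat ψ₁), h2,
      S.measurePreserving.quasiMeasurePreserving.ae hψ₁] with x h3 h4 h5
    rw [h3, h4, h5]
    congr 2
    by_cases hx : x ∈ W₂
    · rw [Set.indicator_of_mem hx, Set.indicator_of_mem (S.swapMap_mem₁_iff.2 hx)]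
    · rw [Set.indicator_of_notMem hx, Set.indicator_of_notMem fun h => hx (S.swapMap_mem₁_iff.1 h)]
  isWavelet := S.interpolationData.isWavelet hψ₁ hψ

omit hψ₁ hψ

/-- A point of $I-c$ or $2^jI$ has its $2^{j}$- or $2^{-j}$-dilate in $W_1$, so it cannot itself lie
in the dyadic tile $W_1$. -/
theorem mem_inter_iff {x : ℝ} : x ∈ W₁ ∩ W₂ ↔ x ∈ P := by
  constructor
  · rintro ⟨h1, h2⟩
    have hI : ∀ {y}, y ∈ I → y ∈ W₁ := fun {y} hy => (S.mem₁ y).2 (Or.inr (Or.inl hy))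
    have hne : ∀ {k : ℤ}, (2 : ℝ) ^ k * x ∈ W₁ → k = 0 := fun {k} hk =>
      S.dyadicTile.eq_of_mem (x := x) hk (by simpa using h1)
    have hj := S.exponent_pos
    rcases (S.mem₂ x).1 h2 with h | h | h
    · exact h
    · have h3 := S.two_pow_mul_sub_mem h
      rw [add_sub_cancel_right] at h3
      have := hne h3
      omega
    · have h3 : (2 : ℝ) ^ (-(j : ℤ)) * x ∈ W₁ := by
        rw [zpow_neg, zpow_natCast, inv_mul_eq_div]
        exact hI h
      have := hne h3
      omega
  · intro h
    exact ⟨(S.mem₁ x).2 (Or.inl h), (S.mem₂ x).2 (Or.inl h)⟩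

theorem swapCoeff₁_eq {J : Set ℝ} (hJ : ∀ x, x ∈ J ↔ x / 2 ^ j + c ∈ I) {x : ℝ} (hx : x ∈ W₁) :
    swapCoeff₁ W₁ I c j x = chi (W₁ ∩ W₂) x + invSqrtTwo * chi (J ∪ I) x := by
  rw [show W₁ ∩ W₂ = P from Set.ext fun x => S.mem_inter_iff]
  have hu : x ∈ J ∪ I ↔ x ∈ J ∨ x ∈ I := Iff.rfl
  rw [hJ] at hu
  rcases (S.mem₁ x).1 hx with h | h | h
  · have h1 := (S.swap_of_mem_P h 0).2.1
    rw [zpow_zero, one_mul] at h1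
    rw [h1, chi, chi, Set.indicator_of_mem h, Set.indicator_of_notMem, Pi.one_apply, mul_zero,
      add_zero]
    rw [hu]
    exact not_or.2 ⟨(S.disjoint_P x h).2, (S.disjoint_P x h).1⟩
  · have h1 := (S.swap_of_mem_I h 0).2.1
    rw [zpow_zero, one_mul] at h1
    rw [h1, chi, chi, Set.indicator_of_mem (hu.2 (Or.inr h)),
      Set.indicator_of_notMem fun h2 => (S.disjoint_P x h2).1 h, Pi.one_apply, mul_one, zero_add]
  · have h1 := (S.swap_of_mem_sub h j).2.1
    rw [← eq_two_pow_mul_sub c j] at h1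
    rw [h1, chi, chi, Set.indicator_of_mem (hu.2 (Or.inl h)),
      Set.indicator_of_notMem fun h2 => (S.disjoint_P x h2).2 h, Pi.one_apply, mul_one, zero_add]

theorem notMem_of_mem_sub {x : ℝ} (hx : x + c ∈ I) : x / 2 ^ j ∉ I := fun h => by
  have h1 := S.two_pow_mul_sub_mem hx
  rw [add_sub_cancel_right] at h1
  have h2 : (2 : ℝ) ^ (-(j : ℤ)) * x ∈ W₁ := by
    rw [zpow_neg, zpow_natCast, inv_mul_eq_div]
    exact (S.mem₁ _).2 (Or.inr (Or.inl h))
  have h3 := S.dyadicTile.eq_of_mem h1 h2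
  have := S.exponent_pos
  omega

theorem swapCoeff₂_eq {B K : Set ℝ} (hB : ∀ x, x ∈ B ↔ x + c ∈ I)
    (hK : ∀ x, x ∈ K ↔ x / 2 ^ j ∈ I) {x : ℝ} (hx : x ∈ W₂) :
    swapCoeff₂ W₁ I c j x = invSqrtTwo * (chi B x - chi K x) := by
  rcases (S.mem₂ x).1 hx with h | h | h
  · have h1 := (S.swap_of_mem_P h 0).2.2
    rw [zpow_zero, one_mul] at h1
    have hW := (S.mem₁ x).2 (Or.inl h)
    have hj := S.exponent_pos
    rw [h1, chi, chi, Set.indicator_of_notMem, Set.indicator_of_notMem, sub_zero, mul_zero]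
    · rw [hK]
      intro h2
      have h3 : (2 : ℝ) ^ (-(j : ℤ)) * x ∈ W₁ := by
        rw [zpow_neg, zpow_natCast, inv_mul_eq_div]
        exact (S.mem₁ _).2 (Or.inr (Or.inl h2))
      have := S.dyadicTile.eq_of_mem h3 (n := 0) (by simpa using hW)
      omega
    · rw [hB]
      intro h2
      have h3 := S.two_pow_mul_sub_mem h2
      rw [add_sub_cancel_right] at h3
      have := S.dyadicTile.eq_of_mem h3 (n := 0) (by simpa using hW)
      omega
  · have h1 := (S.swap_of_mem_sub h 0).2.2
    rw [zpow_zero, one_mul, add_sub_cancel_right] at h1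
    rw [h1, chi, chi, Set.indicator_of_mem ((hB x).2 h),
      Set.indicator_of_notMem fun h2 => S.notMem_of_mem_sub h ((hK x).1 h2), Pi.one_apply,
      sub_zero, mul_one]
  · have h1 := (S.swap_of_mem_I h j).2.2
    rw [zpow_natCast, mul_div_cancel₀ _ (by positivity)] at h1
    rw [h1, chi, chi, Set.indicator_of_mem ((hK x).2 h),
      Set.indicator_of_notMem fun h2 => S.notMem_of_mem_sub ((hB x).1 h2) h, Pi.one_apply,
      zero_sub, mul_neg, mul_one]

/-- Interpolation between the two wavelet sets gives a wavelet in `ℳ_N`. -/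
theorem exists_interpolatedWavelet {J B K : Set ℝ} (hJ : ∀ x, x ∈ J ↔ x / 2 ^ j + c ∈ I)
    (hB : ∀ x, x ∈ B ↔ x + c ∈ I) (hK : ∀ x, x ∈ K ↔ x / 2 ^ j ∈ I) :
    ∃ (σ : ℝ ≃ᵐ ℝ) (h₁ h₂ : ℝ → ℂ) (ψ₁ ψ₂ ψ : L2R),
    IsInterpolatedWavelet W₁ W₂ σ h₁ h₂ ψ₁ ψ₂ ψ ∧
    (∀ x ∈ P, σ x = x) ∧ (∀ x ∈ I, σ x = x - c) ∧ (∀ x ∈ J, σ x = x + 2 ^ j * c) ∧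
    (∀ x ∈ W₁, h₁ x = chi (W₁ ∩ W₂) x + invSqrtTwo * chi (J ∪ I) x) ∧
    (∀ x ∈ W₂, h₂ x = invSqrtTwo * (chi B x - chi K x)) ∧
    ψ ∈ classM N ∧
    ∀ T : Set ℝ, MeasurableSet T → volume T ≠ 0 → volume T ≠ ⊤ →
      (∀ x ∈ T, x + 2 * Real.pi ∉ T) → (∀ x ∈ T, ∃ k : ℤ, 0 < k ∧ (2 : ℝ) ^ k * x ∈ P) →
      (∀ x ∈ T, ∃ k : ℤ, 0 < k ∧ (2 : ℝ) ^ k * (x + 2 * Real.pi) ∈ P) →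
      ¬ IsMRAWavelet ψ ∧ ¬ IsMRAWavelet ψ₁ ∧ ¬ IsMRAWavelet ψ₂ := by
  obtain ⟨ψ₁, hψ₁⟩ := exists_isMSFWavelet S.measurableSet₁ S.dyadicTile S.translationTile
  obtain ⟨ψ₂, hψ₂⟩ := exists_isMSFWavelet S.measurableSet₂ S.dyadicTile₂ S.translationTile₂
  set ψ := fourierEquivL2.symm (S.interpolationData.op (fourierHat ψ₁)) with hψd
  have hψ : fourierHat ψ = S.interpolationData.op (fourierHat ψ₁) := by
    rw [hψd, ← fourierEquivL2_apply, LinearIsometryEquiv.apply_symm_apply]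
  have hP : ∀ x ∈ P, swapMap W₁ I c j x = x := fun x hx => by
    simpa using (S.swap_of_mem_P hx 0).1
  have hP₁ : P ⊆ W₁ := fun x hx => (S.mem₁ x).2 (Or.inl hx)
  have hP₂ : P ⊆ W₂ := fun x hx => (S.mem₂ x).2 (Or.inl hx)
  refine ⟨S.equiv, swapCoeff₁ W₁ I c j, swapCoeff₂ W₁ I c j, ψ₁, ψ₂, ψ,
    S.isInterpolatedWavelet hψ₁.fourier_eq hψ hψ₁ hψ₂, hP, fun x hx => ?_, fun x hx => ?_,
    fun x hx => S.swapCoeff₁_eq hJ hx, fun x hx => S.swapCoeff₂_eq hB hK hx,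
    S.mem_classM hψ₁.fourier_eq hψ,
    fun T hT hT0 hTt hdisj hTP hTP' => ⟨?_, ?_, ?_⟩⟩
  · have h := (S.swap_of_mem_I hx 0).1
    rwa [zpow_zero, one_mul, one_mul] at h
  · have h := (S.swap_of_mem_sub ((hJ x).1 hx) j).1
    rw [← eq_two_pow_mul_sub c j] at h
    refine h.trans ?_
    rw [zpow_natCast, mul_add, mul_div_cancel₀ _ (by positivity)]
  · exact S.interpolationData.not_isMRAWavelet hψ₁.fourier_eq hψ hP₁ hP hT hT0 hTt hdisj hTP hTP'
  · exact not_isMRAWavelet_msf S.measurableSet₁ S.dyadicTile S.translationTile hψ₁ hP₁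
      hT hT0 hTt hdisj hTP hTP'
  · exact not_isMRAWavelet_msf S.measurableSet₂ S.dyadicTile₂ S.translationTile₂ hψ₂ hP₂
      hT hT0 hTt hdisj hTP hTP'

end SwapData

/-! ### Verification of the tiling properties -/

/-- A set obtained from a half-open interval of length `2π` by piecewise `2π`-translations. -/
theorem isTranslationTile_of_shift {W : Set ℝ} (t : ℝ) (τ : ℝ → ℝ)
    (hτ : ∀ x, ∃ k : ℤ, τ x = x + 2 * k * Real.pi)
    (hτW : ∀ x, t * Real.pi ≤ x → x < (t + 2) * Real.pi → τ x ∈ W)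
    (hW : ∀ y ∈ W, ∃ x, t * Real.pi ≤ x ∧ x < (t + 2) * Real.pi ∧ τ x = y) :
    IsTranslationTile W := by
  choose κ hκ using hτ
  have hbase : ∀ x : ℝ, ∃! n : ℤ, t * Real.pi ≤ x + 2 * n * Real.pi ∧
      x + 2 * n * Real.pi < (t + 2) * Real.pi := fun x => by
    have h := existsUnique_add_zsmul_mem_Ico Real.two_pi_pos x (t * Real.pi)
    have h1 : ∀ n : ℤ, x + n • (2 * Real.pi) ∈ Set.Ico (t * Real.pi) (t * Real.pi + 2 * Real.pi) ↔
        t * Real.pi ≤ x + 2 * n * Real.pi ∧ x + 2 * n * Real.pi < (t + 2) * Real.pi := fun n => by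
      rw [Set.mem_Ico, zsmul_eq_mul, add_mul, mul_left_comm, mul_assoc 2]
    simpa only [h1] using h
  intro x
  obtain ⟨n, ⟨hn, hn'⟩, huniq⟩ := hbase x
  refine ⟨n + κ (x + 2 * n * Real.pi), ?_, fun m hm => ?_⟩
  · have h := hτW _ hn hn'
    rw [hκ] at h
    convert h using 1
    push_cast
    ring
  · obtain ⟨z, hz, hz', hzx⟩ := hW _ hm
    rw [hκ] at hzx
    have h1 : z = x + 2 * (m - κ z : ℤ) * Real.pi := by
      push_cast
      linarith
    -- Any preimage of the point lies in the base interval and in the class of $x$, so it is the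
    -- base representative; injectivity of `τ` need not be assumed.
    have h2 : m - κ z = n := huniq _ ⟨by rw [← h1]; exact hz, by rw [← h1]; exact hz'⟩
    rw [h2] at h1
    rw [← h1]
    omega

theorem existsUnique_zpow_mul_mem {a x : ℝ} (ha : 0 < a) (hx : 0 < x) :
    ∃! n : ℤ, a ≤ 2 ^ n * x ∧ 2 ^ n * x < 2 * a := by
  obtain ⟨n, hn⟩ := exists_mem_Ico_zpow (div_pos hx ha) one_lt_two
  have hp : ∀ m : ℤ, (2 : ℝ) ^ (-m) * 2 ^ m = 1 := fun m => by
    rw [← zpow_add₀ two_ne_zero, neg_add_cancel, zpow_zero]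
  obtain ⟨h1, h2⟩ := hn
  rw [le_div_iff₀ ha] at h1
  rw [div_lt_iff₀ ha, zpow_add_one₀ two_ne_zero] at h2
  have h3 : a ≤ 2 ^ (-n) * x := by
    calc a = (2 : ℝ) ^ (-n) * (2 ^ n * a) := by rw [← mul_assoc, hp, one_mul]
      _ ≤ _ := by gcongr
  have h4 : (2 : ℝ) ^ (-n) * x < 2 * a := by
    calc (2 : ℝ) ^ (-n) * x < (2 : ℝ) ^ (-n) * (2 ^ n * 2 * a) := by gcongr
      _ = 2 * a := by rw [mul_assoc, ← mul_assoc, hp, one_mul]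
  have key : ∀ k l : ℤ, a ≤ 2 ^ k * x → 2 ^ l * x < 2 * a → l ≤ k := fun k l hk hl => by
    by_contra! h
    have h5 : (2 : ℝ) ^ (k + 1) ≤ 2 ^ l := zpow_le_zpow_right₀ one_le_two (by omega)
    rw [zpow_add_one₀ two_ne_zero] at h5
    nlinarith [mul_le_mul_of_nonneg_right h5 hx.le]
  exact ⟨-n, ⟨h3, h4⟩, fun m hm => le_antisymm (key _ _ h3 hm.2) (key _ _ hm.1 h4)⟩

/-- Reflection alone would put the closed endpoint on the wrong side. The map $x\mapsto(-x)^{-1}$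
keeps the order on the negative axis and sends $[-2a,-a)$ to $[1/(2a),1/a)$. -/
theorem existsUnique_zpow_mul_mem_neg {a x : ℝ} (ha : 0 < a) (hx : x < 0) :
    ∃! n : ℤ, -(2 * a) ≤ 2 ^ n * x ∧ 2 ^ n * x < -a := by
  obtain ⟨n, hn, huniq⟩ := existsUnique_zpow_mul_mem (a := (2 * a)⁻¹) (x := (-x)⁻¹)
    (by positivity) (inv_pos.2 (neg_pos.2 hx))
  have key : ∀ m : ℤ, (-(2 * a) ≤ 2 ^ m * x ∧ 2 ^ m * x < -a) ↔
      ((2 * a)⁻¹ ≤ 2 ^ (-m) * (-x)⁻¹ ∧ 2 ^ (-m) * (-x)⁻¹ < 2 * (2 * a)⁻¹) := fun m => by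
    have h0 : 0 < (2 : ℝ) ^ m * (-x) := mul_pos (zpow_pos two_pos m) (neg_pos.2 hx)
    rw [zpow_neg, ← mul_inv, inv_le_inv₀ (by positivity) h0,
      show 2 * (2 * a)⁻¹ = a⁻¹ by field_simp, inv_lt_inv₀ h0 ha, mul_neg, neg_le, lt_neg]
  refine ⟨-n, (key _).2 (by rwa [neg_neg]), fun m hm => ?_⟩
  have := huniq _ ((key m).1 hm)
  omega

/-- A set obtained from `[-2aπ, -aπ) ∪ [aπ, 2aπ)` by piecewise dyadic dilations. -/
theorem isDyadicTile_of_dilate {W : Set ℝ} {a : ℝ} (ha : 0 < a) (τ : ℝ → ℝ)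
    (hτ : ∀ x, ∃ n : ℤ, τ x = 2 ^ n * x)
    (hτW : ∀ x, (-(2 * a) * Real.pi ≤ x ∧ x < -a * Real.pi) ∨
      (a * Real.pi ≤ x ∧ x < 2 * a * Real.pi) → τ x ∈ W)
    (hW : ∀ y ∈ W, ∃ x, ((-(2 * a) * Real.pi ≤ x ∧ x < -a * Real.pi) ∨
      (a * Real.pi ≤ x ∧ x < 2 * a * Real.pi)) ∧ τ x = y) :
    IsDyadicTile W := by
  choose κ hκ using hτ
  have haπ : 0 < a * Real.pi := mul_pos ha Real.pi_pos
  have hbase : ∀ x : ℝ, x ≠ 0 → ∃! n : ℤ,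
      (-(2 * a) * Real.pi ≤ 2 ^ n * x ∧ 2 ^ n * x < -a * Real.pi) ∨
      (a * Real.pi ≤ 2 ^ n * x ∧ 2 ^ n * x < 2 * a * Real.pi) := fun x hx => by
    rcases lt_or_gt_of_ne hx with h | h
    · have h1 : ∀ n : ℤ, ((-(2 * a) * Real.pi ≤ 2 ^ n * x ∧ 2 ^ n * x < -a * Real.pi) ∨
          (a * Real.pi ≤ 2 ^ n * x ∧ 2 ^ n * x < 2 * a * Real.pi)) ↔
          (-(2 * (a * Real.pi)) ≤ 2 ^ n * x ∧ 2 ^ n * x < -(a * Real.pi)) := fun n => by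
        have h2 : (2 : ℝ) ^ n * x < 0 := mul_neg_of_pos_of_neg (zpow_pos two_pos n) h
        rw [neg_mul, neg_mul, mul_assoc, or_iff_left]
        rintro ⟨h3, -⟩
        linarith
      simpa only [h1] using existsUnique_zpow_mul_mem_neg haπ h
    · have h1 : ∀ n : ℤ, ((-(2 * a) * Real.pi ≤ 2 ^ n * x ∧ 2 ^ n * x < -a * Real.pi) ∨
          (a * Real.pi ≤ 2 ^ n * x ∧ 2 ^ n * x < 2 * a * Real.pi)) ↔
          (a * Real.pi ≤ 2 ^ n * x ∧ 2 ^ n * x < 2 * (a * Real.pi)) := fun n => by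
        have h2 : 0 < (2 : ℝ) ^ n * x := mul_pos (zpow_pos two_pos n) h
        rw [mul_assoc 2, or_iff_right]
        rintro ⟨-, h3⟩
        linarith
      simpa only [h1] using existsUnique_zpow_mul_mem haπ h
  refine ⟨fun h => ?_, fun x hx => ?_⟩
  · obtain ⟨x, hx, h0⟩ := hW 0 h
    rw [hκ] at h0
    have hx0 : x = 0 := (mul_eq_zero.1 h0).resolve_left (zpow_pos two_pos _).ne'
    subst hx0
    rcases hx with ⟨-, h1⟩ | ⟨h1, -⟩ <;> linarith
  · obtain ⟨n, hn, huniq⟩ := hbase x hx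
    refine ⟨κ (2 ^ n * x) + n, ?_, fun m hm => ?_⟩
    · have h := hτW _ hn
      rwa [hκ, ← mul_assoc, ← zpow_add₀ two_ne_zero] at h
    · obtain ⟨z, hz, hzx⟩ := hW _ hm
      rw [hκ] at hzx
      have h1 : z = 2 ^ (m - κ z) * x := by
        rw [sub_eq_neg_add, zpow_add₀ two_ne_zero, mul_assoc, ← hzx, ← mul_assoc,
          ← zpow_add₀ two_ne_zero, neg_add_cancel, zpow_zero, one_mul]
      have h2 : m - κ z = n := huniq _ (by simp only [← h1]; exact hz)
      rw [h2] at h1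
      rw [← h1]
      omega

/-! ### The four pairs of wavelet sets -/

theorem measurableSet_piIco (a b : ℝ) : MeasurableSet (piIco a b) := measurableSet_Ico

theorem volume_piIco_ne_zero {a b : ℝ} (h : a < b) : volume (piIco a b) ≠ 0 := by
  rw [piIco, Real.volume_Ico, Ne, ENNReal.ofReal_eq_zero, not_le, ← sub_mul]
  exact mul_pos (sub_pos.2 h) Real.pi_pos

theorem volume_piIco_ne_top (a b : ℝ) : volume (piIco a b) ≠ ⊤ := by
  rw [piIco, Real.volume_Ico]
  exact ENNReal.ofReal_ne_top

theorem isTranslationTile_set₁M₁ : IsTranslationTile set₁M₁ := by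
  have := Real.pi_pos
  refine isTranslationTile_of_shift (4 / 7) (fun x =>
      if x < 6 / 7 * Real.pi then x else if x < 10 / 7 * Real.pi then x - 2 * Real.pi else
      x + 2 * Real.pi)
    (fun x => ?_) (fun x h1 h2 => ?_) fun y hy => ?_
  · split_ifs
    exacts [⟨0, by push_cast; ring⟩, ⟨-1, by push_cast; ring⟩, ⟨1, by push_cast; ring⟩]
  · simp only [set₁M₁, piIco, Set.mem_union, Set.mem_Ico]
    split_ifs <;> grind
  · simp only [set₁M₁, piIco, Set.mem_union, Set.mem_Ico] at hy
    rcases hy with (⟨h1, h2⟩ | ⟨h1, h2⟩) | ⟨h1, h2⟩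
    · exact ⟨y + 2 * Real.pi, by grind⟩
    · exact ⟨y, by grind⟩
    · exact ⟨y - 2 * Real.pi, by grind⟩

theorem isDyadicTile_set₁M₁ : IsDyadicTile set₁M₁ := by
  have := Real.pi_pos
  -- Only $[6\pi/7,8\pi/7)$ has to move: four times it is $[24\pi/7,32\pi/7)$.
  refine isDyadicTile_of_dilate (a := 4 / 7) (by norm_num) (fun x =>
      if x < 6 / 7 * Real.pi then x else 4 * x)
    (fun x => ?_) (fun x h => ?_) fun y hy => ?_
  · split_ifs
    exacts [⟨0, by norm_num⟩, ⟨2, by norm_num⟩]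
  · simp only [set₁M₁, piIco, Set.mem_union, Set.mem_Ico]
    split_ifs <;> grind
  · simp only [set₁M₁, piIco, Set.mem_union, Set.mem_Ico] at hy
    rcases hy with (⟨h1, h2⟩ | ⟨h1, h2⟩) | ⟨h1, h2⟩
    · exact ⟨y, by grind⟩
    · exact ⟨y, by grind⟩
    · exact ⟨y / 4, by grind⟩

/-- The common part of the two sets. -/
def commonM₁ : Set ℝ := piIco (-8 / 7) (-4 / 7) ∪ piIco (24 / 7) (30 / 7) ∪ piIco (31 / 7) (32 / 7)

/-- Here $I-4\pi=[2\pi/7,3\pi/7)$, whose double is the piece $[4\pi/7,6\pi/7)$ of $W_1$. -/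
theorem swapData_M₁ : SwapData set₁M₁ set₂M₁ commonM₁ (piIco (30 / 7) (31 / 7)) (4 * Real.pi) 1 1 := by
  have := Real.pi_pos
  constructor
  case measurableSet_P => exact ((measurableSet_piIco _ _).union (measurableSet_piIco _ _)).union (measurableSet_piIco _ _)
  case measurableSet_I => exact measurableSet_piIco _ _
  case volume_ne_zero => exact volume_piIco_ne_zero (by norm_num)
  case volume_ne_top => exact volume_piIco_ne_top _ _
  case dyadicTile => exact isDyadicTile_set₁M₁
  case translationTile => exact isTranslationTile_set₁M₁
  case shift_eq => norm_num
  case exponent_pos => norm_num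
  all_goals
    intro x
    simp only [set₁M₁, set₂M₁, commonM₁, piIco, Set.mem_union, Set.mem_Ico]
    grind

theorem isTranslationTile_set₁M₂ : IsTranslationTile set₁M₂ := by
  have := Real.pi_pos
  refine isTranslationTile_of_shift (8 / 15) (fun x =>
      if x < 14 / 15 * Real.pi then x else if x < Real.pi then x - 2 * Real.pi else
      if x < 16 / 15 * Real.pi then x else if x < 22 / 15 * Real.pi then x - 2 * Real.pi else
      if x < 2 * Real.pi then x + 6 * Real.pi else x - 10 * Real.pi)
    (fun x => ?_) (fun x h1 h2 => ?_) fun y hy => ?_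
  · split_ifs
    exacts [⟨0, by push_cast; ring⟩, ⟨-1, by push_cast; ring⟩, ⟨0, by push_cast; ring⟩, ⟨-1, by push_cast; ring⟩, ⟨3, by push_cast; ring⟩, ⟨-5, by push_cast; ring⟩]
  · simp only [set₁M₂, piIco, Set.mem_union, Set.mem_Ico]
    split_ifs <;> grind
  · simp only [set₁M₂, piIco, Set.mem_union, Set.mem_Ico] at hy
    rcases hy with ((((⟨h1, h2⟩ | ⟨h1, h2⟩) | ⟨h1, h2⟩) | ⟨h1, h2⟩) | ⟨h1, h2⟩) | ⟨h1, h2⟩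
    · exact ⟨y + 10 * Real.pi, by grind⟩
    · exact ⟨y + 2 * Real.pi, by grind⟩
    · exact ⟨y + 2 * Real.pi, by grind⟩
    · exact ⟨y, by grind⟩
    · exact ⟨y, by grind⟩
    · exact ⟨y - 6 * Real.pi, by grind⟩

theorem isDyadicTile_set₁M₂ : IsDyadicTile set₁M₂ := by
  have := Real.pi_pos
  -- The gaps $[-\pi,-14\pi/15)$ and $[14\pi/15,\pi)$ of $W_1$ are filled by its outer pieces
  -- divided by $8$.
  refine isDyadicTile_of_dilate (a := 8 / 15) (by norm_num) (fun x =>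
      if (-Real.pi ≤ x ∧ x < -(14 / 15) * Real.pi) ∨ (14 / 15 * Real.pi ≤ x ∧ x < Real.pi)
      then 8 * x else x)
    (fun x => ?_) (fun x h => ?_) fun y hy => ?_
  · split_ifs
    exacts [⟨3, by norm_num⟩, ⟨0, by norm_num⟩]
  · simp only [set₁M₂, piIco, Set.mem_union, Set.mem_Ico]
    split_ifs <;> grind
  · simp only [set₁M₂, piIco, Set.mem_union, Set.mem_Ico] at hy
    rcases hy with ((((⟨h1, h2⟩ | ⟨h1, h2⟩) | ⟨h1, h2⟩) | ⟨h1, h2⟩) | ⟨h1, h2⟩) | ⟨h1, h2⟩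
    · exact ⟨y / 8, by grind⟩
    · exact ⟨y, by grind⟩
    · exact ⟨y, by grind⟩
    · exact ⟨y, by grind⟩
    · exact ⟨y, by grind⟩
    · exact ⟨y / 8, by grind⟩

/-- The common part of the two sets. -/
def commonM₂ : Set ℝ := piIco (-8) (-112 / 15) ∪ piIco (-14 / 15) (-8 / 15) ∪ piIco (8 / 15) (14 / 15) ∪ piIco 1 (16 / 15) ∪ piIco (225 / 30) 8

theorem swapData_M₂ : SwapData set₁M₂ set₂M₂ commonM₂ (piIco (112 / 15) (225 / 30)) (8 * Real.pi) 1 2 := by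
  have := Real.pi_pos
  constructor
  case measurableSet_P => exact ((((measurableSet_piIco _ _).union (measurableSet_piIco _ _)).union (measurableSet_piIco _ _)).union (measurableSet_piIco _ _)).union (measurableSet_piIco _ _)
  case measurableSet_I => exact measurableSet_piIco _ _
  case volume_ne_zero => exact volume_piIco_ne_zero (by norm_num)
  case volume_ne_top => exact volume_piIco_ne_top _ _
  case dyadicTile => exact isDyadicTile_set₁M₂
  case translationTile => exact isTranslationTile_set₁M₂
  case shift_eq => norm_num
  case exponent_pos => norm_num
  all_goals
    intro x
    simp only [set₁M₂, set₂M₂, commonM₂, piIco, Set.mem_union, Set.mem_Ico]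
    grind

theorem isTranslationTile_set₁M₃ : IsTranslationTile set₁M₃ := by
  have := Real.pi_pos
  refine isTranslationTile_of_shift (16 / 31) (fun x =>
      if x < 30 / 31 * Real.pi then x else if x < Real.pi then x - 2 * Real.pi else
      if x < 32 / 31 * Real.pi then x else if x < 46 / 31 * Real.pi then x - 2 * Real.pi else
      if x < 2 * Real.pi then x + 14 * Real.pi else x - 18 * Real.pi)
    (fun x => ?_) (fun x h1 h2 => ?_) fun y hy => ?_
  · split_ifs
    exacts [⟨0, by push_cast; ring⟩, ⟨-1, by push_cast; ring⟩, ⟨0, by push_cast; ring⟩, ⟨-1, by push_cast; ring⟩, ⟨7, by push_cast; ring⟩, ⟨-9, by push_cast; ring⟩]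
  · simp only [set₁M₃, piIco, Set.mem_union, Set.mem_Ico]
    split_ifs <;> grind
  · simp only [set₁M₃, piIco, Set.mem_union, Set.mem_Ico] at hy
    rcases hy with ((((⟨h1, h2⟩ | ⟨h1, h2⟩) | ⟨h1, h2⟩) | ⟨h1, h2⟩) | ⟨h1, h2⟩) | ⟨h1, h2⟩
    · exact ⟨y + 18 * Real.pi, by grind⟩
    · exact ⟨y + 2 * Real.pi, by grind⟩
    · exact ⟨y + 2 * Real.pi, by grind⟩
    · exact ⟨y, by grind⟩
    · exact ⟨y, by grind⟩
    · exact ⟨y - 14 * Real.pi, by grind⟩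

theorem isDyadicTile_set₁M₃ : IsDyadicTile set₁M₃ := by
  have := Real.pi_pos
  refine isDyadicTile_of_dilate (a := 16 / 31) (by norm_num) (fun x =>
      if (-Real.pi ≤ x ∧ x < -(30 / 31) * Real.pi) ∨ (30 / 31 * Real.pi ≤ x ∧ x < Real.pi)
      then 16 * x else x)
    (fun x => ?_) (fun x h => ?_) fun y hy => ?_
  · split_ifs
    exacts [⟨4, by norm_num⟩, ⟨0, by norm_num⟩]
  · simp only [set₁M₃, piIco, Set.mem_union, Set.mem_Ico]
    split_ifs <;> grind
  · simp only [set₁M₃, piIco, Set.mem_union, Set.mem_Ico] at hy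
    rcases hy with ((((⟨h1, h2⟩ | ⟨h1, h2⟩) | ⟨h1, h2⟩) | ⟨h1, h2⟩) | ⟨h1, h2⟩) | ⟨h1, h2⟩
    · exact ⟨y / 16, by grind⟩
    · exact ⟨y, by grind⟩
    · exact ⟨y, by grind⟩
    · exact ⟨y, by grind⟩
    · exact ⟨y, by grind⟩
    · exact ⟨y / 16, by grind⟩

/-- The common part of the two sets. -/
def commonM₃ : Set ℝ := piIco (-16) (-480 / 31) ∪ piIco (-30 / 31) (-16 / 31) ∪ piIco (16 / 31) (30 / 31) ∪ piIco 1 (32 / 31) ∪ piIco (31 / 2) 16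

theorem swapData_M₃ : SwapData set₁M₃ set₂M₃ commonM₃ (piIco (480 / 31) (31 / 2)) (16 * Real.pi) 1 3 := by
  have := Real.pi_pos
  constructor
  case measurableSet_P => exact ((((measurableSet_piIco _ _).union (measurableSet_piIco _ _)).union (measurableSet_piIco _ _)).union (measurableSet_piIco _ _)).union (measurableSet_piIco _ _)
  case measurableSet_I => exact measurableSet_piIco _ _
  case volume_ne_zero => exact volume_piIco_ne_zero (by norm_num)
  case volume_ne_top => exact volume_piIco_ne_top _ _
  case dyadicTile => exact isDyadicTile_set₁M₃
  case translationTile => exact isTranslationTile_set₁M₃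
  case shift_eq => norm_num
  case exponent_pos => norm_num
  all_goals
    intro x
    simp only [set₁M₃, set₂M₃, commonM₃, piIco, Set.mem_union, Set.mem_Ico]
    grind

theorem isTranslationTile_set₁M₀ : IsTranslationTile set₁M₀ := by
  have := Real.pi_pos
  refine isTranslationTile_of_shift (4 / 7) (fun x =>
      if x < Real.pi then x else if x < 10 / 7 * Real.pi then x - 2 * Real.pi else
      if x < 2 * Real.pi then x - 6 * Real.pi else x + 2 * Real.pi)
    (fun x => ?_) (fun x h1 h2 => ?_) fun y hy => ?_
  · split_ifs
    exacts [⟨0, by push_cast; ring⟩, ⟨-1, by push_cast; ring⟩, ⟨-3, by push_cast; ring⟩, ⟨1, by push_cast; ring⟩]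
  · simp only [set₁M₀, piIco, Set.mem_union, Set.mem_Ico]
    split_ifs <;> grind
  · simp only [set₁M₀, piIco, Set.mem_union, Set.mem_Ico] at hy
    rcases hy with ((⟨h1, h2⟩ | ⟨h1, h2⟩) | ⟨h1, h2⟩) | ⟨h1, h2⟩
    · exact ⟨y + 6 * Real.pi, by grind⟩
    · exact ⟨y + 2 * Real.pi, by grind⟩
    · exact ⟨y, by grind⟩
    · exact ⟨y - 2 * Real.pi, by grind⟩

theorem isDyadicTile_set₁M₀ : IsDyadicTile set₁M₀ := by
  have := Real.pi_pos
  refine isDyadicTile_of_dilate (a := 4 / 7) (by norm_num) (fun x =>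
      if x < -Real.pi ∨ Real.pi ≤ x then 4 * x else x)
    (fun x => ?_) (fun x h => ?_) fun y hy => ?_
  · split_ifs
    exacts [⟨2, by norm_num⟩, ⟨0, by norm_num⟩]
  · simp only [set₁M₀, piIco, Set.mem_union, Set.mem_Ico]
    split_ifs <;> grind
  · simp only [set₁M₀, piIco, Set.mem_union, Set.mem_Ico] at hy
    rcases hy with ((⟨h1, h2⟩ | ⟨h1, h2⟩) | ⟨h1, h2⟩) | ⟨h1, h2⟩
    · exact ⟨y / 4, by grind⟩
    · exact ⟨y, by grind⟩
    · exact ⟨y, by grind⟩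
    · exact ⟨y / 4, by grind⟩

/-- The common part of the two sets. -/
def commonM₀ : Set ℝ := piIco (-1) (-4 / 7) ∪ piIco (4 / 7) (6 / 7) ∪ piIco 4 (32 / 7)

/-- The only pair with $j=2$: $I-2\pi=[-8\pi/7,-\pi)$ reaches $W_1$ after multiplication by $4$. -/
theorem swapData_M₀ : SwapData set₁M₀ set₂M₀ commonM₀ (piIco (6 / 7) 1) (2 * Real.pi) 2 0 := by
  have := Real.pi_pos
  constructor
  case measurableSet_P => exact ((measurableSet_piIco _ _).union (measurableSet_piIco _ _)).union (measurableSet_piIco _ _)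
  case measurableSet_I => exact measurableSet_piIco _ _
  case volume_ne_zero => exact volume_piIco_ne_zero (by norm_num)
  case volume_ne_top => exact volume_piIco_ne_top _ _
  case dyadicTile => exact isDyadicTile_set₁M₀
  case translationTile => exact isTranslationTile_set₁M₀
  case shift_eq => norm_num
  case exponent_pos => norm_num
  all_goals
    intro x
    simp only [set₁M₀, set₂M₀, commonM₀, piIco, Set.mem_union, Set.mem_Ico]
    grind

theorem exists_wavelet_M₁ : ∃ (σ : ℝ ≃ᵐ ℝ) (h₁ h₂ : ℝ → ℂ) (ψ₁ ψ₂ ψ : L2R),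
    IsInterpolatedWavelet set₁M₁ set₂M₁ σ h₁ h₂ ψ₁ ψ₂ ψ ∧
    (∀ ξ ∈ commonM₁, σ ξ = ξ) ∧
    (∀ ξ ∈ piIco (30 / 7) (31 / 7), σ ξ = ξ - 4 * Real.pi) ∧
    (∀ ξ ∈ piIco (4 / 7) (6 / 7), σ ξ = ξ + 8 * Real.pi) ∧
    (∀ ξ ∈ set₁M₁, h₁ ξ = chi (set₁M₁ ∩ set₂M₁) ξ +
      invSqrtTwo * chi (piIco (4 / 7) (6 / 7) ∪ piIco (30 / 7) (31 / 7)) ξ) ∧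
    (∀ ξ ∈ set₂M₁, h₂ ξ = invSqrtTwo *
      (chi (piIco (2 / 7) (3 / 7)) ξ - chi (piIco (60 / 7) (62 / 7)) ξ)) ∧
    ψ ∈ classM 1 := by
  have hπ := Real.pi_pos
  obtain ⟨σ, h₁, h₂, ψ₁, ψ₂, ψ, hψ, hP, hI, hJ, hh₁, hh₂, hM, -⟩ :=
    swapData_M₁.exists_interpolatedWavelet (J := piIco (4 / 7) (6 / 7))
      (B := piIco (2 / 7) (3 / 7)) (K := piIco (60 / 7) (62 / 7))
      (fun x => by simp only [piIco, Set.mem_Ico]; grind)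
      (fun x => by simp only [piIco, Set.mem_Ico]; grind)
      (fun x => by simp only [piIco, Set.mem_Ico]; grind)
  exact ⟨σ, h₁, h₂, ψ₁, ψ₂, ψ, hψ, hP, hI,
    fun ξ hξ => (hJ ξ hξ).trans (by ring), hh₁, hh₂, hM⟩

theorem exists_wavelet_M₂ : ∃ (σ : ℝ ≃ᵐ ℝ) (h₁ h₂ : ℝ → ℂ) (ψ₁ ψ₂ ψ : L2R),
    IsInterpolatedWavelet set₁M₂ set₂M₂ σ h₁ h₂ ψ₁ ψ₂ ψ ∧
    (∀ ξ ∈ commonM₂, σ ξ = ξ) ∧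
    (∀ ξ ∈ piIco (112 / 15) (225 / 30), σ ξ = ξ - 8 * Real.pi) ∧
    (∀ ξ ∈ piIco (-16 / 15) (-1), σ ξ = ξ + 16 * Real.pi) ∧
    (∀ ξ ∈ set₁M₂, h₁ ξ = chi (set₁M₂ ∩ set₂M₂) ξ +
      invSqrtTwo * chi (piIco (-16 / 15) (-1) ∪ piIco (112 / 15) (225 / 30)) ξ) ∧
    (∀ ξ ∈ set₂M₂, h₂ ξ = invSqrtTwo *
      (chi (piIco (-8 / 15) (-1 / 2)) ξ - chi (piIco (224 / 15) 15) ξ)) ∧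
    ψ ∈ classM 2 := by
  have hπ := Real.pi_pos
  obtain ⟨σ, h₁, h₂, ψ₁, ψ₂, ψ, hψ, hP, hI, hJ, hh₁, hh₂, hM, -⟩ :=
    swapData_M₂.exists_interpolatedWavelet (J := piIco (-16 / 15) (-1))
      (B := piIco (-8 / 15) (-1 / 2)) (K := piIco (224 / 15) 15)
      (fun x => by simp only [piIco, Set.mem_Ico]; grind)
      (fun x => by simp only [piIco, Set.mem_Ico]; grind)
      (fun x => by simp only [piIco, Set.mem_Ico]; grind)
  exact ⟨σ, h₁, h₂, ψ₁, ψ₂, ψ, hψ, hP, hI,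
    fun ξ hξ => (hJ ξ hξ).trans (by ring), hh₁, hh₂, hM⟩

theorem exists_wavelet_M₃ : ∃ (σ : ℝ ≃ᵐ ℝ) (h₁ h₂ : ℝ → ℂ) (ψ₁ ψ₂ ψ : L2R),
    IsInterpolatedWavelet set₁M₃ set₂M₃ σ h₁ h₂ ψ₁ ψ₂ ψ ∧
    (∀ ξ ∈ commonM₃, σ ξ = ξ) ∧
    (∀ ξ ∈ piIco (480 / 31) (31 / 2), σ ξ = ξ - 16 * Real.pi) ∧
    (∀ ξ ∈ piIco (-32 / 31) (-1), σ ξ = ξ + 32 * Real.pi) ∧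
    (∀ ξ ∈ set₁M₃, h₁ ξ = chi (set₁M₃ ∩ set₂M₃) ξ +
      invSqrtTwo * chi (piIco (-32 / 31) (-1) ∪ piIco (480 / 31) (31 / 2)) ξ) ∧
    (∀ ξ ∈ set₂M₃, h₂ ξ = invSqrtTwo *
      (chi (piIco (-16 / 31) (-1 / 2)) ξ - chi (piIco (960 / 31) 31) ξ)) ∧
    ψ ∈ classM 3 := by
  have hπ := Real.pi_pos
  obtain ⟨σ, h₁, h₂, ψ₁, ψ₂, ψ, hψ, hP, hI, hJ, hh₁, hh₂, hM, -⟩ :=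
    swapData_M₃.exists_interpolatedWavelet (J := piIco (-32 / 31) (-1))
      (B := piIco (-16 / 31) (-1 / 2)) (K := piIco (960 / 31) 31)
      (fun x => by simp only [piIco, Set.mem_Ico]; grind)
      (fun x => by simp only [piIco, Set.mem_Ico]; grind)
      (fun x => by simp only [piIco, Set.mem_Ico]; grind)
  exact ⟨σ, h₁, h₂, ψ₁, ψ₂, ψ, hψ, hP, hI,
    fun ξ hξ => (hJ ξ hξ).trans (by ring), hh₁, hh₂, hM⟩

theorem exists_wavelet_M₀ : ∃ (σ : ℝ ≃ᵐ ℝ) (h₁ h₂ : ℝ → ℂ) (ψ₁ ψ₂ ψ : L2R),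
    IsInterpolatedWavelet set₁M₀ set₂M₀ σ h₁ h₂ ψ₁ ψ₂ ψ ∧
    (∀ ξ ∈ commonM₀, σ ξ = ξ) ∧
    (∀ ξ ∈ piIco (6 / 7) 1, σ ξ = ξ - 2 * Real.pi) ∧
    (∀ ξ ∈ piIco (-32 / 7) (-4), σ ξ = ξ + 8 * Real.pi) ∧
    (∀ ξ ∈ set₁M₀, h₁ ξ = chi (set₁M₀ ∩ set₂M₀) ξ +
      invSqrtTwo * chi (piIco (-32 / 7) (-4) ∪ piIco (6 / 7) 1) ξ) ∧
    (∀ ξ ∈ set₂M₀, h₂ ξ = invSqrtTwo *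
      (chi (piIco (-8 / 7) (-1)) ξ - chi (piIco (24 / 7) 4) ξ)) ∧
    ψ ∈ classM 0 ∧ ¬ IsMRAWavelet ψ ∧ ¬ IsMRAWavelet ψ₁ ∧ ¬ IsMRAWavelet ψ₂ := by
  have hπ := Real.pi_pos
  obtain ⟨σ, h₁, h₂, ψ₁, ψ₂, ψ, hψ, hP, hI, hJ, hh₁, hh₂, hM, hT⟩ :=
    swapData_M₀.exists_interpolatedWavelet (J := piIco (-32 / 7) (-4))
      (B := piIco (-8 / 7) (-1)) (K := piIco (24 / 7) 4)
      (fun x => by simp only [piIco, Set.mem_Ico]; grind)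
      (fun x => by simp only [piIco, Set.mem_Ico]; grind)
      (fun x => by simp only [piIco, Set.mem_Ico]; grind)
  refine ⟨σ, h₁, h₂, ψ₁, ψ₂, ψ, hψ, hP, hI,
    fun ξ hξ => (hJ ξ hξ).trans (by ring), hh₁, hh₂, hM, ?_⟩
  -- For $T=[\pi/4,2\pi/7)$ both $16T=[4\pi,32\pi/7)$ and $2(T+2\pi)=[9\pi/2,32\pi/7)$ lie in the
  -- common piece $[4\pi,32\pi/7)$, which explains the exponents $4$ and $1$.
  refine hT (piIco (1 / 4) (2 / 7)) (measurableSet_piIco _ _) (volume_piIco_ne_zero (by norm_num))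
    (volume_piIco_ne_top _ _) (fun x hx hx' => ?_) (fun x hx => ⟨4, by norm_num, ?_⟩)
    (fun x hx => ⟨1, by norm_num, ?_⟩)
  · have h1 := hx.1
    have h2 := hx'.2
    linarith
  · right
    obtain ⟨h1, h2⟩ := hx
    constructor <;> norm_num <;> linarith
  · right
    obtain ⟨h1, h2⟩ := hx
    constructor <;> norm_num <;> linarith

end WaveletInvariance

end

theorem mainTheorem6 :
    -- a wavelet in `ℳ₁`
    (∃ (σ : ℝ ≃ᵐ ℝ) (h₁ h₂ : ℝ → ℂ) (ψ₁ ψ₂ ψ : L2R),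
      IsInterpolatedWavelet set₁M₁ set₂M₁
        σ h₁ h₂ ψ₁ ψ₂ ψ ∧
      (∀ ξ ∈ set₁M₁ ∩ set₂M₁, σ ξ = ξ) ∧
      (∀ ξ ∈ piIco (30 / 7) (31 / 7), σ ξ = ξ - 4 * Real.pi) ∧
      (∀ ξ ∈ piIco (4 / 7) (6 / 7), σ ξ = ξ + 8 * Real.pi) ∧
      (∀ ξ ∈ set₁M₁, h₁ ξ =
        chi (set₁M₁ ∩ set₂M₁) ξ +
        invSqrtTwo * chi
          (piIco (4 / 7) (6 / 7) ∪ piIco (30 / 7) (31 / 7)) ξ) ∧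
      (∀ ξ ∈ set₂M₁, h₂ ξ = invSqrtTwo *
        (chi (piIco (2 / 7) (3 / 7)) ξ -
          chi (piIco (60 / 7) (62 / 7)) ξ)) ∧
      ψ ∈ classM 1) ∧
    -- a wavelet in `ℳ₂`
    (∃ (σ : ℝ ≃ᵐ ℝ) (h₁ h₂ : ℝ → ℂ) (ψ₁ ψ₂ ψ : L2R),
      IsInterpolatedWavelet set₁M₂ set₂M₂
        σ h₁ h₂ ψ₁ ψ₂ ψ ∧
      (∀ ξ ∈ set₁M₂ ∩ set₂M₂, σ ξ = ξ) ∧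
      (∀ ξ ∈ piIco (112 / 15) (225 / 30), σ ξ = ξ - 8 * Real.pi) ∧
      (∀ ξ ∈ piIco (-16 / 15) (-1), σ ξ = ξ + 16 * Real.pi) ∧
      (∀ ξ ∈ set₁M₂, h₁ ξ =
        chi (set₁M₂ ∩ set₂M₂) ξ +
        invSqrtTwo * chi
          (piIco (-16 / 15) (-1) ∪
            piIco (112 / 15) (225 / 30)) ξ) ∧
      (∀ ξ ∈ set₂M₂, h₂ ξ = invSqrtTwo *
        (chi (piIco (-8 / 15) (-1 / 2)) ξ -
          chi (piIco (224 / 15) 15) ξ)) ∧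
      ψ ∈ classM 2) ∧
    -- a wavelet in `ℳ₃`
    (∃ (σ : ℝ ≃ᵐ ℝ) (h₁ h₂ : ℝ → ℂ) (ψ₁ ψ₂ ψ : L2R),
      IsInterpolatedWavelet set₁M₃ set₂M₃
        σ h₁ h₂ ψ₁ ψ₂ ψ ∧
      (∀ ξ ∈ set₁M₃ ∩ set₂M₃, σ ξ = ξ) ∧
      (∀ ξ ∈ piIco (480 / 31) (31 / 2), σ ξ = ξ - 16 * Real.pi) ∧
      (∀ ξ ∈ piIco (-32 / 31) (-1), σ ξ = ξ + 32 * Real.pi) ∧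
      (∀ ξ ∈ set₁M₃, h₁ ξ =
        chi (set₁M₃ ∩ set₂M₃) ξ +
        invSqrtTwo * chi
          (piIco (-32 / 31) (-1) ∪
            piIco (480 / 31) (31 / 2)) ξ) ∧
      (∀ ξ ∈ set₂M₃, h₂ ξ = invSqrtTwo *
        (chi (piIco (-16 / 31) (-1 / 2)) ξ -
          chi (piIco (960 / 31) 31) ξ)) ∧
      ψ ∈ classM 3) ∧
    -- a non-MRA wavelet in `ℳ₀`
    (∃ (σ : ℝ ≃ᵐ ℝ) (h₁ h₂ : ℝ → ℂ) (ψ₁ ψ₂ ψ : L2R),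
      IsInterpolatedWavelet set₁M₀ set₂M₀
        σ h₁ h₂ ψ₁ ψ₂ ψ ∧
      (∀ ξ ∈ piIco (-1) (-4 / 7) ∪ piIco (4 / 7) (6 / 7) ∪
        piIco 4 (32 / 7), σ ξ = ξ) ∧
      (∀ ξ ∈ piIco (6 / 7) 1, σ ξ = ξ - 2 * Real.pi) ∧
      (∀ ξ ∈ piIco (-32 / 7) (-4), σ ξ = ξ + 8 * Real.pi) ∧
      (∀ ξ ∈ set₁M₀, h₁ ξ =
        chi (set₁M₀ ∩ set₂M₀) ξ +
        invSqrtTwo * chi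
          (piIco (-32 / 7) (-4) ∪ piIco (6 / 7) 1) ξ) ∧
      (∀ ξ ∈ set₂M₀, h₂ ξ = invSqrtTwo *
        (chi (piIco (-8 / 7) (-1)) ξ -
          chi (piIco (24 / 7) 4) ξ)) ∧
      ψ ∈ classM 0 ∧
      ¬ IsMRAWavelet ψ ∧
      ¬ IsMRAWavelet ψ₁ ∧
      ¬ IsMRAWavelet ψ₂) ∧
    -- the classes are non-empty
    (∀ n : ℕ, n ≤ 3 → (classM n).Nonempty) := by
  obtain ⟨σ₁, f₁, g₁, a₁, b₁, ψ₁, h₁, hP₁, hI₁, hJ₁, hf₁, hg₁, hM₁⟩ := exists_wavelet_M₁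
  obtain ⟨σ₂, f₂, g₂, a₂, b₂, ψ₂, h₂, hP₂, hI₂, hJ₂, hf₂, hg₂, hM₂⟩ := exists_wavelet_M₂
  obtain ⟨σ₃, f₃, g₃, a₃, b₃, ψ₃, h₃, hP₃, hI₃, hJ₃, hf₃, hg₃, hM₃⟩ := exists_wavelet_M₃
  obtain ⟨σ₀, f₀, g₀, a₀, b₀, ψ₀, h₀, hP₀, hI₀, hJ₀, hf₀, hg₀, hM₀, hn₀⟩ := exists_wavelet_M₀
  refine ⟨⟨σ₁, f₁, g₁, a₁, b₁, ψ₁, h₁, fun ξ hξ => hP₁ ξ (swapData_M₁.mem_inter_iff.1 hξ),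
      hI₁, hJ₁, hf₁, hg₁, hM₁⟩,
    ⟨σ₂, f₂, g₂, a₂, b₂, ψ₂, h₂, fun ξ hξ => hP₂ ξ (swapData_M₂.mem_inter_iff.1 hξ),
      hI₂, hJ₂, hf₂, hg₂, hM₂⟩,
    ⟨σ₃, f₃, g₃, a₃, b₃, ψ₃, h₃, fun ξ hξ => hP₃ ξ (swapData_M₃.mem_inter_iff.1 hξ),
      hI₃, hJ₃, hf₃, hg₃, hM₃⟩,
    ⟨σ₀, f₀, g₀, a₀, b₀, ψ₀, h₀, hP₀, hI₀, hJ₀, hf₀, hg₀, hM₀, hn₀⟩, fun n hn => ?_⟩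
  interval_cases n
  exacts [⟨ψ₀, hM₀⟩, ⟨ψ₁, hM₁⟩, ⟨ψ₂, hM₂⟩, ⟨ψ₃, hM₃⟩]
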